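/- **Setting.** Fix an integer $M\ge 1$. Let $\Omega_M=\{0,1,\dots,M\}^{\mathbb N}$ with left shift $\sigma$ and lexicographical order $\prec,\preceq$, let $\overline{(x_i)}=(M-x_i)$ denote reflection (likewise for words), and for a word $c_1\dots c_m$ with $c_m<M$ put $c_1\dots c_m^+=c_1\dots c_{m-1}(c_m+1)$. For $q\in(1,M+1]$ put $\pi_q((x_i))=\sum_{i\ge1}x_iq^{-i}$, let $\alpha(q)$ be the quasi-greedy $q$-expansion of $1$, i.e. the lexicographically largest $x\in\Omega_M$ not ending with $0^\infty$ with $\pi_q(x)=1$, and let $$\mathbf U_q=\{x\in\Omega_M:\ \pi_q(y)\ne\pi_q(x)\text{ for all } y\in\Omega_M\setminus\{x\}\},\qquad \widetilde{\mathbf U}_q=\{x\in\Omega_M:\ \overline{\alpha(q)}\prec\sigma^n(x)\prec\alpha(q)\ \ \forall n\ge0\},$$ $$\mathcal V=\{q\in(1,M+1]:\ \overline{\alpha(q)}\preceq\sigma^n(\alpha(q))\preceq\alpha(q)\ \ \forall n\ge 0\}.$$ For $X\subset\Omega_M$ let $B_n(X)$ be the set of length $n$ prefixes of the sequences in $X$,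 let $h(X)=\lim_{n\to\infty}\frac1n\log\#B_n(X)$ if the limit exists, and put $H(q)=h(\mathbf U_q)$. A superscript $*$ means that the alphabet is $\{0,1\}$ (that is, $M=1$). Let $\mathbf u$ be the word $k$ if $M=2k$, and the word $(k+1)k$ if $M=2k+1$. Let $q_G,q_T\in(1,M+1]$ be the bases with $\alpha(q_G)=\mathbf u^\infty$ and $\alpha(q_T)=\mathbf u^+(\overline{\mathbf u})^\infty$. Let $G$ be the directed graph with vertices $\mathrm{Start},A,B$ and edges $e_0:\mathrm{Start}\to A$, $e_1:A\to B$, $e_2:B\to B$, $e_3:B\to A$, $e_4:A\to A$. Label $e_0,\dots,e_4$ by the blocks $\mathbf u^+,\overline{\mathbf u^+},\mathbf u,\mathbf u^+,\overline{\mathbf u}$ respectively (labeling $\mathcal L_{\mathbf u}$), and by $1,0,0,1,1$ respectively (labeling $\mathcal L^*$). Let $X_{\mathbf u}\subset\Omega_M$ be the set of concatenations of the $\mathcal L_{\mathbf u}$-labels along infinite paths from $\mathrm{Start}$. Each $x\in X_{\mathbf u}$ comes from exactly one such path, and $\Phi_{\mathbf u}(x)\in\{0,1\}^{\mathbb N}$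 is the sequence of $\mathcal L^*$-labels of that path. **Proposition.** Let $q\in(q_G,q_T]\cap\mathcal V$. Then $\alpha(q)\in X_{\mathbf u}$, and there is $\hat q\in\mathcal V^*$ with $\alpha^*(\hat q)=\Phi_{\mathbf u}(\alpha(q))$; it is unique, since $\alpha^*$ is injective, and is denoted $\hat q=\hat\Phi_{\mathbf u}(q)$. Moreover: (i) the set $\{x\in\widetilde{\mathbf U}_q:\ x_1\dots x_{|\mathbf u|}=\mathbf u^+\}$ is contained in $X_{\mathbf u}$, and $$\Phi_{\mathbf u}\big(\{x\in\widetilde{\mathbf U}_q:\ x_1\dots x_{|\mathbf u|}=\mathbf u^+\}\big)=\{y\in\widetilde{\mathbf U}^*_{\hat q}:\ y_1=1\};$$ (ii) the limits defining $H(q)=h(\mathbf U_q)$ and $H^*(\hat q)=h(\mathbf U^*_{\hat q})$ exist, and $H(q)=c_M H^*(\hat q)$, where $c_M=1$ if $M$ is even and $c_M=\frac12$ if $M$ is odd. -/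

import Mathlib

open Filter Topology

namespace Univoque

/-- The space of infinite sequences over the alphabet `{0, 1, …, M}`. The digit written `x₁` in
mathematical notation is `x 0`, and so on. For two sequences, the strict and non-strict
lexicographical orders are `toLex x < toLex y` and `toLex x ≤ toLex y`. -/
abbrev Omega (M : ℕ) : Type := ℕ → Fin (M + 1)

/-- Finite words over the alphabet `{0, 1, …, M}`. -/
abbrev Word (M : ℕ) : Type := List (Fin (M + 1))

/-- The left shift, iterated `n` times. -/
def shift {M : ℕ} (n : ℕ) (x : Omega M) : Omega M := fun i => x (i + n)

/-- The reflection `(M - x_i)` of a sequence. -/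
def reflection {M : ℕ} (x : Omega M) : Omega M := fun i => Fin.rev (x i)

/-- The reflection of a word. -/
def Word.reflection {M : ℕ} (w : Word M) : Word M := w.map Fin.rev

/-- `w⁺`: the last digit is increased by one (meant for words whose last digit is `< M`). -/
def Word.plus {M : ℕ} : Word M → Word M
  | [] => []
  | [d] => [d + 1]
  | d :: d' :: w => d :: Word.plus (d' :: w)

/-- The word consisting of the first `n` digits of `x`. -/
def initialWord {M : ℕ} (n : ℕ) (x : Omega M) : Word M := List.ofFn fun i : Fin n => x i

/-- The eventually periodic sequence `v w^∞`, for `w` non-empty. -/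
def evPeriodic {M : ℕ} (v w : Word M) : Omega M := fun i =>
  if i < v.length then v.getD i 0 else w.getD ((i - v.length) % w.length) 0

/-- The infinite concatenation `d₁ d₂ d₃ …` of blocks, all of the same length `m ≥ 1`. -/
def concat {M : ℕ} (m : ℕ) (d : ℕ → Word M) : Omega M := fun i => (d (i / m)).getD (i % m) 0

/-! ### Expansions in base `q` -/

/-- `π_q(x₁ x₂ …) = ∑_{i ≥ 1} x_i / q^i` (a convergent series for `q > 1`). -/
noncomputable def piq {M : ℕ} (q : ℝ) (x : Omega M) : ℝ :=
  ∑' i : ℕ, ((x i : ℕ) : ℝ) / q ^ (i + 1)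

/-- The numbers that have a unique expansion in base `q` over the alphabet `{0, …, M}`. -/
def univoqueNumbers (M : ℕ) (q : ℝ) : Set ℝ := {t | ∃! x : Omega M, piq q x = t}

/-- The symbolic univoque set `𝐔_q`. -/
def univoqueSeqs (M : ℕ) (q : ℝ) : Set (Omega M) := {x | piq q x ∈ univoqueNumbers M q}

/-- The expansions of `1` in base `q` which do not end with `0^∞`. -/
def infiniteExpansions (M : ℕ) (q : ℝ) : Set (Omega M) :=
  {x | piq q x = 1 ∧ ¬ ∃ N, ∀ i, N ≤ i → x i = 0}

/-- `a` is the quasi-greedy expansion of `1` in base `q`: the lexicographically largest among the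
expansions of `1` that do not end with `0^∞`. -/
def IsQuasiGreedy (M : ℕ) (q : ℝ) (a : Omega M) : Prop :=
  a ∈ infiniteExpansions M q ∧ ∀ b ∈ infiniteExpansions M q, toLex b ≤ toLex a

/-- The quasi-greedy expansion `α(q)` of `1` in base `q`, for `q ∈ (1, M + 1]`. -/
noncomputable def alpha (M : ℕ) (q : ℝ) : Omega M := Classical.epsilon (IsQuasiGreedy M q)

/-- The inverse of `α` (which is injective on `(1, M + 1]`): for a sequence `s` in the range of
`α`, the base `q ∈ (1, M + 1]` with `α(q) = s`. -/
noncomputable def baseOf {M : ℕ} (s : Omega M) : ℝ :=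
  Classical.epsilon fun q : ℝ => 1 < q ∧ q ≤ M + 1 ∧ alpha M q = s

/-- The set `𝐕` of sequences `c` with `reflection c ≼ σⁿ c ≼ c` for all `n ≥ 0`. -/
def seqV (M : ℕ) : Set (Omega M) :=
  {c | ∀ n, toLex (reflection c) ≤ toLex (shift n c) ∧ toLex (shift n c) ≤ toLex c}

/-- The set `𝒱` of bases `q ∈ (1, M + 1]` with `α(q) ∈ 𝐕`. -/
def basesV (M : ℕ) : Set ℝ := {q | 1 < q ∧ q ≤ M + 1 ∧ alpha M q ∈ seqV M}

/-- The set `𝐔̃_q` of sequences with `reflection α(q) ≺ σⁿ x ≺ α(q)` for all `n ≥ 0`. -/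
def tildeU (M : ℕ) (q : ℝ) : Set (Omega M) :=
  {x | ∀ n, toLex (reflection (alpha M q)) < toLex (shift n x) ∧
    toLex (shift n x) < toLex (alpha M q)}

/-! ### Topological entropy -/

/-- `B_n(X)`: the set of length `n` initial words of the sequences in `X`. -/
def initialWords {M : ℕ} (n : ℕ) (X : Set (Omega M)) : Set (Word M) := initialWord n '' X

/-- The topological entropy of `X` exists and equals `h`. -/
def HasEntropy {M : ℕ} (X : Set (Omega M)) (h : ℝ) : Prop :=
  Tendsto (fun n : ℕ => Real.log ((initialWords n X).ncard : ℝ) / n) atTop (𝓝 h)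

/-- The topological entropy `h(X) = lim_n log #B_n(X) / n`. -/
noncomputable def entropy {M : ℕ} (X : Set (Omega M)) : ℝ :=
  limUnder atTop fun n : ℕ => Real.log ((initialWords n X).ncard : ℝ) / n

/-- The entropy function `H(q) = h(𝐔_q)` for the alphabet `{0, …, M}`. -/
noncomputable def entropyFn (M : ℕ) (q : ℝ) : ℝ := entropy (univoqueSeqs M q)

/-! ### The special bases `q_G` and `q_T` -/

/-- The Thue-Morse sequence `τ_i`: the parity of the sum of the binary digits of `i`. -/
def tau (i : ℕ) : ℕ := (Nat.digits 2 i).sum % 2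

/-- The digits `λ_i(M)`, `i ≥ 1`, of the quasi-greedy expansion of `1` in the Komornik-Loreti base:
`k + τ_i - τ_{i-1}` if `M = 2k`, and `k + τ_i` if `M = 2k + 1`. -/
def lam (M : ℕ) (i : ℕ) : Fin (M + 1) :=
  if Even M then Fin.ofNat (M + 1) (M / 2 + tau i - tau (i - 1))
  else Fin.ofNat (M + 1) (M / 2 + tau i)

/-- The word `λ_1 … λ_n`. -/
def lamWord (M : ℕ) (n : ℕ) : Word M := List.ofFn fun i : Fin n => lam M (i + 1)

/-- The sequence `α(q_n')`, for `n ≥ 1`. -/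
def alphaPrime (M n : ℕ) : Omega M :=
  if Even M then evPeriodic (lamWord M (2 ^ (n - 1))) (lamWord M (2 ^ (n - 1))).reflection.plus
  else evPeriodic (lamWord M (2 ^ n)) (lamWord M (2 ^ n)).reflection.plus

/-- The base `q_n'`, for `n ≥ 1`. -/
noncomputable def qPrime (M n : ℕ) : ℝ := baseOf (alphaPrime M n)

/-- The transitive base `q_T = q_1'`. -/
noncomputable def qT (M : ℕ) : ℝ := qPrime M 1

/-- The unit lift `𝐮`: the word `k` if `M = 2k`, and the word `(k+1)k` if `M = 2k + 1`. -/
def unitLift (M : ℕ) : Word M :=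
  if Even M then [Fin.ofNat (M + 1) (M / 2)]
  else [Fin.ofNat (M + 1) (M / 2 + 1), Fin.ofNat (M + 1) (M / 2)]

/-- The generalized golden ratio `q_G`: the base with `α(q_G) = k^∞` if `M = 2k`, and
`α(q_G) = ((k+1)k)^∞` if `M = 2k + 1`. -/
noncomputable def qG (M : ℕ) : ℝ := baseOf (evPeriodic [] (unitLift M))

/-! ### The labeled graphs and the block map -/

/-- The vertices of the graph `G`. -/
inductive Vertex
  | start
  | A
  | B

/-- The edges of the graph `G`. -/
inductive Edge
  | e0
  | e1
  | e2
  | e3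
  | e4

/-- The initial vertex of an edge. -/
def Edge.src : Edge → Vertex
  | .e0 => .start
  | .e1 => .A
  | .e2 => .B
  | .e3 => .B
  | .e4 => .A

/-- The terminal vertex of an edge. -/
def Edge.tgt : Edge → Vertex
  | .e0 => .A
  | .e1 => .B
  | .e2 => .B
  | .e3 => .A
  | .e4 => .A

/-- The labeling `ℒ_a` of the edges by the blocks `a`, `a⁺` and their reflections. -/
def blockLabel {M : ℕ} (a : Word M) : Edge → Word M
  | .e0 => a.plus
  | .e1 => a.plus.reflection
  | .e2 => a
  | .e3 => a.plus
  | .e4 => a.reflection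

/-- The labeling `ℒ^*` of the edges by `0` and `1`. -/
def starLabel : Edge → Fin 2
  | .e0 => 1
  | .e1 => 0
  | .e2 => 0
  | .e3 => 1
  | .e4 => 1

/-- The infinite paths in `G` that begin at the vertex `start`. -/
def IsPath (e : ℕ → Edge) : Prop :=
  (e 0).src = .start ∧ ∀ i, (e i).tgt = (e (i + 1)).src

/-- `e` is an infinite path from `start` whose sequence of block labels spells out `x`. -/
def Spells {M : ℕ} (a : Word M) (e : ℕ → Edge) (x : Omega M) : Prop :=
  IsPath e ∧ x = concat a.length fun i => blockLabel a (e i)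

/-- The set `X_a` of sequences generated by the graph with the labeling `ℒ_a`. -/
def blockSeqs {M : ℕ} (a : Word M) : Set (Omega M) := {x | ∃ e, Spells a e x}

open Classical in
/-- The block map `Φ_a : X_a → X^*`, sending the sequence of `ℒ_a`-labels of a path to its
sequence of `ℒ^*`-labels. (For a fundamental word `a` the path is determined by the sequence.
Outside `X_a`, where `Φ_a` is not defined, the value is set to `0^∞`, which is not in `X^*`.) -/
noncomputable def blockMap {M : ℕ} (a : Word M) (x : Omega M) : Omega 1 :=
  if h : ∃ e, Spells a e x then fun i => starLabel (h.choose i) else fun _ => 0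

/-- The induced map on bases, `q ↦ (α^*)⁻¹ (Φ_a (α(q)))`. -/
noncomputable def baseMap {M : ℕ} (a : Word M) (q : ℝ) : ℝ := baseOf (blockMap a (alpha M q))

/-- `c_M = 1` for even `M` and `1/2` for odd `M`. -/
noncomputable def cConst (M : ℕ) : ℝ := if Even M then 1 else 1 / 2

end Univoque

open Univoque

namespace Univoque

/-! ### The lexicographical order, shifts and reflection -/

section Lex

variable {M : ℕ}

/-! Remember only whether a path sits at A (state 1) or elsewhere (state 0). The `starLabel` of an
edge is the state it enters, so a path is a 0-1 sequence `y`, and its concatenated blocks are `code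
M 0 y`: the digits `k + y i - y (i-1)` if `M = 2k`, the pairs `(k + 1 - y (i-1)), (k + y i)` if `M =
2k+1`. The map `Φ_𝐮` inverts this code.

The code is strictly increasing (`code_lt_iff`), shifting it by a block restarts it from the state
reached (`shift_code`), and reflection swaps the states (`reflection_code`). A bound `σⁿ x ≺ α(q) =
code M 0 b` with `b 0 = 1` has content only at block boundaries in state 0: in state 1 it is
automatic (`code_one_lt_code_zero`), as it is inside a block (`shift_code_lt`). On the binary side
the bound is inherited past a digit 1, because dropping a leading maximal digit never increases a
sequence. So the lexicographic conditions on `y` and on its code are equivalent. This gives `b ∈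
seqV 1`, hence `q̂`, and part (i).

That the relevant sequences are codes at all is `BoundedByOnes.exists_code`: `q ≤ q_T` bounds all
tails, and those of the reflection, by `𝐮⁺ (reflection 𝐮)^∞`. After `𝐮⁺` this leaves exactly the two
choices of the graph at each block.

For (ii), `𝐔_q` and `𝐔̃_q` differ by an initial constant run and one digit. A sequence of `𝐔̃_q` is,
up to reflection, a piece of an alternating or constant word followed by a sequence as in (i). Such
changes alter word counts by at most a linear factor, so not the entropy, which exists by shift
invariance. Words of `|𝐮| n` digits of codes starting with `𝐮⁺` correspond to words of `n` binary
digits, whence `c_M = 1 / |𝐮|`. -/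

theorem lex_lt_iff {x y : Omega M} :
    toLex x < toLex y ↔ ∃ n, (∀ i < n, x i = y i) ∧ x n < y n := Iff.rfl

theorem shift_shift (m n : ℕ) (x : Omega M) : shift m (shift n x) = shift (m + n) x := by
  funext i
  simp [shift, add_assoc]

theorem shift_zero (x : Omega M) : shift 0 x = x := rfl

theorem reflection_reflection (x : Omega M) : reflection (reflection x) = x := by
  funext i
  simp [reflection]

theorem reflection_shift (n : ℕ) (x : Omega M) :
    reflection (shift n x) = shift n (reflection x) := rfl

theorem reflection_val (x : Omega M) (i : ℕ) : (reflection x i : ℕ) + x i = M := by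
  simp only [reflection, Fin.val_rev]
  have := (x i).isLt
  omega

theorem reflection_lt_reflection {x y : Omega M} :
    toLex (reflection x) < toLex (reflection y) ↔ toLex y < toLex x := by
  simp only [lex_lt_iff, reflection, Fin.rev_inj, Fin.rev_lt_rev]
  constructor <;> rintro ⟨n, h, h'⟩ <;> exact ⟨n, fun i hi => (h i hi).symm, h'⟩

theorem reflection_le_reflection {x y : Omega M} :
    toLex (reflection x) ≤ toLex (reflection y) ↔ toLex y ≤ toLex x := by
  exact le_iff_le_iff_lt_iff_lt.2 reflection_lt_reflection

theorem reflection_lt {x y : Omega M} :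
    toLex (reflection x) < toLex y ↔ toLex (reflection y) < toLex x := by
  rw [← reflection_lt_reflection, reflection_reflection]

theorem reflection_le {x y : Omega M} :
    toLex (reflection x) ≤ toLex y ↔ toLex (reflection y) ≤ toLex x := by
  rw [← reflection_le_reflection, reflection_reflection]

/-- At the first position where the smaller sequence could exceed the larger one, it does not. -/
theorem digit_le_of_lex_le {x y : Omega M} (h : toLex x ≤ toLex y) {n : ℕ}
    (hn : ∀ i < n, x i = y i) : x n ≤ y n := by
  by_contra hlt
  exact absurd h (not_le.2 ⟨n, fun i hi => (hn i hi).symm, not_le.1 hlt⟩)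

/-- Removing a leading digit `M` does not increase a sequence. -/
theorem shift_one_le_of_last {x : Omega M} (h : x 0 = Fin.last M) :
    toLex (shift 1 x) ≤ toLex x := by
  by_contra hlt
  obtain ⟨n, h1, h2⟩ := lex_lt_iff.1 (not_le.1 hlt)
  -- Agreement of `x` with its own shift propagates the leading digit up to position `n`, where
  -- nothing can be larger.
  have hc : ∀ i, i ≤ n → x i = Fin.last M := by
    intro i
    induction i with
    | zero => exact fun _ => h
    | succ i ih =>
      intro hi
      have := h1 i (by omega)
      rw [← ih (by omega), this]
      rfl
  rw [hc n le_rfl] at h2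
  exact absurd h2 (not_lt.2 (Fin.le_last _))

theorem shift_succ_le_of_last {x : Omega M} {n : ℕ} (h : x n = Fin.last M) :
    toLex (shift (n + 1) x) ≤ toLex (shift n x) := by
  have := shift_one_le_of_last (x := shift n x) (by simpa [shift] using h)
  rwa [shift_shift, add_comm 1 n] at this

theorem le_shift_succ_of_zero {x : Omega M} {n : ℕ} (h : x n = 0) :
    toLex (shift n x) ≤ toLex (shift (n + 1) x) := by
  rw [← reflection_le_reflection]
  exact shift_succ_le_of_last (x := reflection x) (by simp [reflection, h])

end Lex

/-! ### Values of sequences in base `q` -/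

section Values

variable {M : ℕ} {q : ℝ}

theorem summable_piq (hq : 1 < q) (x : Omega M) :
    Summable fun i : ℕ => ((x i : ℕ) : ℝ) / q ^ (i + 1) := by
  have hg : Summable fun i : ℕ => (M : ℝ) * (1 / q) ^ (i + 1) :=
    ((summable_nat_add_iff 1).2 (summable_geometric_of_lt_one (by positivity)
      (by rw [div_lt_one (by linarith)]; exact hq))).mul_left _
  refine Summable.of_nonneg_of_le (fun i => by positivity) (fun i => ?_) hg
  rw [one_div, inv_pow, ← div_eq_mul_inv]
  have : ((x i : ℕ) : ℝ) ≤ M := by exact_mod_cast Nat.lt_succ_iff.1 (x i).isLt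
  gcongr

theorem piq_nonneg (hq : 1 < q) (x : Omega M) : 0 ≤ piq q x :=
  tsum_nonneg fun i => by positivity

theorem piq_eq_digit_add (hq : 1 < q) (x : Omega M) :
    piq q x = ((x 0 : ℕ) + piq q (shift 1 x)) / q := by
  have h0 : q ≠ 0 := by linarith
  rw [piq, (summable_piq hq x).tsum_eq_zero_add, piq, add_div, ← tsum_div_const]
  congr 1
  · simp
  · congr 1
    funext i
    simp only [shift]
    rw [div_div, ← pow_succ]

theorem hasSum_geometric_tail (hq : 1 < q) (M : ℕ) :
    HasSum (fun i : ℕ => (M : ℝ) / q ^ (i + 1)) (M / (q - 1)) := by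
  have h := (hasSum_geometric_of_lt_one (r := 1 / q) (by positivity)
    (by rw [div_lt_one (by linarith)]; exact hq)).mul_left (M / q : ℝ)
  have h0 : q ≠ 0 := by linarith
  have h1 : q - 1 ≠ 0 := by linarith
  have h2 : (fun i : ℕ => (M : ℝ) / q ^ (i + 1)) = fun i => M / q * (1 / q) ^ i := by
    funext i
    rw [one_div, inv_pow, pow_succ]
    field_simp
  have h3 : (M : ℝ) / (q - 1) = M / q * (1 - 1 / q)⁻¹ := by
    rw [one_sub_div h0, inv_div]
    field_simp
  rwa [h2, h3]

theorem piq_add_reflection (hq : 1 < q) (x : Omega M) :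
    piq q (reflection x) + piq q x = M / (q - 1) := by
  rw [piq, piq, ← (summable_piq hq _).tsum_add (summable_piq hq _),
    ← (hasSum_geometric_tail hq M).tsum_eq]
  congr 1
  funext i
  rw [← add_div]
  congr 1
  exact_mod_cast reflection_val x i

theorem piq_le (hq : 1 < q) (x : Omega M) : piq q x ≤ M / (q - 1) := by
  have := piq_add_reflection hq x
  have := piq_nonneg hq (reflection x)
  linarith

theorem piq_sub_of_agree (hq : 1 < q) {x y : Omega M} {n : ℕ} (h : ∀ i < n, x i = y i) :
    piq q x - piq q y = (piq q (shift n x) - piq q (shift n y)) / q ^ n := by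
  induction n with
  | zero => simp [shift_zero]
  | succ n ih =>
    have h0 : q ≠ 0 := by linarith
    rw [ih fun i hi => h i (by omega), piq_eq_digit_add hq (shift n x),
      piq_eq_digit_add hq (shift n y), shift_shift, shift_shift, add_comm 1 n]
    have : shift n x 0 = shift n y 0 := by simpa [shift] using h n (by omega)
    rw [this, pow_succ]
    field_simp
    ring

theorem piq_sub_of_agree_digit (hq : 1 < q) {x y : Omega M} {n : ℕ} (h : ∀ i < n, x i = y i) :
    piq q x - piq q y = ((x n : ℕ) - (y n : ℕ) +
      (piq q (shift (n + 1) x) - piq q (shift (n + 1) y))) / q ^ (n + 1) := by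
  have h0 : q ≠ 0 := by linarith
  rw [piq_sub_of_agree hq h, piq_eq_digit_add hq (shift n x), piq_eq_digit_add hq (shift n y),
      shift_shift, shift_shift, add_comm 1 n, pow_succ]
  have hx : shift n x 0 = x n := by simp [shift]
  have hy : shift n y 0 = y n := by simp [shift]
  rw [hx, hy]
  field_simp
  ring

theorem piq_pos (hq : 1 < q) {x : Omega M} {n : ℕ} (h : x n ≠ 0) : 0 < piq q x := by
  refine (summable_piq hq x).tsum_pos (fun i => by positivity) n ?_
  have : 0 < (x n : ℕ) := Nat.pos_of_ne_zero fun h' => h (Fin.ext h')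
  positivity

theorem piq_shift_pos (hq : 1 < q) {x : Omega M} (h : ¬ ∃ N, ∀ i, N ≤ i → x i = 0) (n : ℕ) :
    0 < piq q (shift n x) := by
  push Not at h
  obtain ⟨i, hi, hx⟩ := h n
  refine piq_pos hq (n := i - n) ?_
  simpa [shift, Nat.sub_add_cancel hi] using hx

/-- If a sequence of digits is produced by a digit choice that keeps the remainders in a bounded
set, then the remainders are the values of the tails. -/
theorem exists_piq_shift_mem (hq : 1 < q) {I : Set ℝ} {B : ℝ} (hB : ∀ v ∈ I, |v| ≤ B)
    {d : ℝ → Fin (M + 1)} (hd : ∀ v ∈ I, q * v - (d v : ℕ) ∈ I) {v : ℝ} (hv : v ∈ I) :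
    ∃ x : Omega M, piq q x = v ∧ ∀ n, piq q (shift n x) ∈ I := by
  have h0 : 0 < q := by linarith
  let r : ℕ → ℝ := fun n => (fun v => q * v - (d v : ℕ))^[n] v
  have hr : ∀ n, r (n + 1) = q * r n - (d (r n) : ℕ) := fun n =>
    Function.iterate_succ_apply' _ _ _
  have hrI : ∀ n, r n ∈ I := by
    intro n
    induction n with
    | zero => exact hv
    | succ n ih => rw [hr]; exact hd _ ih
  let x : Omega M := fun n => d (r n)
  have hstep : ∀ n, r n - piq q (shift n x) =
      (r (n + 1) - piq q (shift (n + 1) x)) / q := by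
    intro n
    rw [piq_eq_digit_add hq (shift n x), shift_shift, add_comm 1 n, hr]
    have : shift n x 0 = d (r n) := by simp [shift, x]
    rw [this]
    field_simp
    ring
  -- The discrepancy between remainder and tail value grows by the factor `q` at each step, yet is
  -- bounded by `B + M / (q - 1)`; hence it vanishes.
  have hiter : ∀ N n, r n - piq q (shift n x) =
      (r (n + N) - piq q (shift (n + N) x)) / q ^ N := by
    intro N
    induction N with
    | zero => simp
    | succ N ih =>
      intro n
      rw [hstep, ih, div_div, ← pow_succ, show n + 1 + N = n + (N + 1) by ring]
  have heq : ∀ n, piq q (shift n x) = r n := by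
    intro n
    have hlim : Tendsto (fun N : ℕ => (B + M / (q - 1)) * (1 / q) ^ N) atTop (𝓝 0) := by
      have := (tendsto_pow_atTop_nhds_zero_of_lt_one (r := 1 / q) (by positivity)
        (by rw [div_lt_one h0]; exact hq)).const_mul (B + M / (q - 1))
      simpa using this
    have hle : |r n - piq q (shift n x)| ≤ 0 := by
      refine ge_of_tendsto' hlim fun N => ?_
      rw [hiter N n, abs_div, abs_of_pos (pow_pos h0 N), one_div, inv_pow, ← div_eq_mul_inv]
      gcongr
      refine (abs_sub _ _).trans (add_le_add (hB _ (hrI _)) ?_)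
      rw [abs_of_nonneg (piq_nonneg hq _)]
      exact piq_le hq _
    have := abs_nonpos_iff.1 hle
    linarith
  exact ⟨x, heq 0, fun n => by rw [heq]; exact hrI n⟩

/-- Greedy digits keep the remainder in `[0, M/(q-1)]`. When the digit is not capped at `M`, the new
remainder is below 1, and `q ≤ M + 1` makes the interval contain `[0, 1]`. -/
theorem exists_piq_eq (hq : 1 < q) (hqM : q ≤ M + 1) {v : ℝ} (h0 : 0 ≤ v)
    (hv : v ≤ M / (q - 1)) : ∃ x : Omega M, piq q x = v := by
  have hq1 : 0 < q - 1 := by linarith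
  have hone : 1 ≤ M / (q - 1) := by rw [le_div_iff₀ hq1]; linarith
  have key := exists_piq_shift_mem hq (M := M) (I := Set.Icc 0 (M / (q - 1)))
    (B := M / (q - 1)) (fun v hv => by rw [abs_of_nonneg hv.1]; exact hv.2)
    (d := fun v => ⟨min M ⌊q * v⌋₊, by omega⟩) (v := v) ?_ ⟨h0, hv⟩
  · exact key.imp fun x h => h.1
  · rintro v ⟨hv0, hv1⟩
    have hqv : 0 ≤ q * v := by positivity
    have hfl := Nat.floor_le hqv
    have hfl' := Nat.lt_floor_add_one (q * v)
    rcases le_total M ⌊q * v⌋₊ with h | h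
    · simp only [min_eq_left h]
      have : (M : ℝ) ≤ ⌊q * v⌋₊ := by exact_mod_cast h
      refine ⟨by linarith, ?_⟩
      have h2 : q * v ≤ q * (M / (q - 1)) := by gcongr
      have h3 : q * (M / (q - 1)) - M = M / (q - 1) := by field_simp; ring
      linarith
    · simp only [min_eq_right h]
      exact ⟨by linarith, by linarith⟩

end Values

/-! ### Quasi-greedy expansions -/

section QuasiGreedy

variable {M : ℕ} {q : ℝ}

/-- A competitor that is first larger at position `n` gains at least one unit there and has a
positive tail, while the tail of `a` is worth at most one unit; so the values differ. -/
theorem isQuasiGreedy_of_tails (hq : 1 < q) {a : Omega M} (ha : piq q a = 1)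
    (h : ∀ n, piq q (shift n a) ∈ Set.Ioc (0 : ℝ) 1) : IsQuasiGreedy M q a := by
  refine ⟨⟨ha, ?_⟩, ?_⟩
  · rintro ⟨N, hN⟩
    have h1 := (h N).1
    have h2 : piq q (shift N a) = 0 := by
      rw [piq, show (fun i : ℕ => ((shift N a i : ℕ) : ℝ) / q ^ (i + 1)) = fun _ => 0 from ?_]
      · simp
      · funext i
        simp [shift, hN (i + N) (by omega)]
    linarith
  · rintro b ⟨hb1, hb2⟩
    by_contra hlt
    obtain ⟨n, h1, h2⟩ := lex_lt_iff.1 (not_le.1 hlt)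
    have h3 := piq_sub_of_agree_digit hq h1
    have h0 : 0 < q ^ (n + 1) := by positivity
    rw [ha, hb1, sub_self, eq_comm, div_eq_zero_iff] at h3
    have h4 := (h (n + 1)).2
    have h5 := piq_shift_pos hq hb2 (n + 1)
    have h6 : ((a n : ℕ) : ℝ) + 1 ≤ (b n : ℕ) := by exact_mod_cast h2
    rcases h3 with h3 | h3 <;> linarith

theorem IsQuasiGreedy.unique {a b : Omega M} (ha : IsQuasiGreedy M q a)
    (hb : IsQuasiGreedy M q b) : a = b :=
  toLex.injective (le_antisymm (hb.2 a ha.1) (ha.2 b hb.1))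

/-- The quasi-greedy expansion exists; all its tails have values in `(0, 1]`. -/
theorem exists_tails_mem (hq : 1 < q) (hqM : q ≤ M + 1) :
    ∃ a : Omega M, piq q a = 1 ∧ ∀ n, piq q (shift n a) ∈ Set.Ioc (0 : ℝ) 1 := by
  -- The digit `⌈q v⌉ - 1` is the largest one that leaves a strictly positive remainder. The `min`
  -- only types it as a digit: `q v ≤ M + 1` keeps it at most `M`.
  refine exists_piq_shift_mem hq (M := M) (I := Set.Ioc (0 : ℝ) 1) (B := 1)
    (fun v hv => by rw [abs_of_pos hv.1]; exact hv.2)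
    (d := fun v => ⟨min M (⌈q * v⌉₊ - 1), by omega⟩) (v := 1) ?_ ⟨one_pos, le_rfl⟩
  rintro v ⟨hv0, hv1⟩
  have hqv : 0 < q * v := by positivity
  have h1 : ⌈q * v⌉₊ ≤ M + 1 := by
    rw [Nat.ceil_le]
    push_cast
    nlinarith
  have h2 : 0 < ⌈q * v⌉₊ := Nat.ceil_pos.2 hqv
  have h3 := Nat.le_ceil (q * v)
  have h4 := Nat.ceil_lt_add_one hqv.le
  obtain ⟨c, hc⟩ : ∃ c, ⌈q * v⌉₊ = c + 1 := ⟨_, (Nat.succ_pred_eq_of_pos h2).symm⟩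
  rw [hc] at h1 h3 h4
  push_cast at h3 h4
  simp only [hc, Nat.add_sub_cancel, min_eq_right (show c ≤ M by omega)]
  exact ⟨by linarith, by linarith⟩

theorem alpha_eq_of_tails (hq : 1 < q) {a : Omega M} (ha : piq q a = 1)
    (h : ∀ n, piq q (shift n a) ∈ Set.Ioc (0 : ℝ) 1) : alpha M q = a :=
  (Classical.epsilon_spec (p := IsQuasiGreedy M q)
    ⟨a, isQuasiGreedy_of_tails hq ha h⟩).unique (isQuasiGreedy_of_tails hq ha h)

theorem piq_alpha (hq : 1 < q) (hqM : q ≤ M + 1) : piq q (alpha M q) = 1 := by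
  obtain ⟨a, ha, h⟩ := exists_tails_mem hq hqM
  rwa [alpha_eq_of_tails hq ha h]

theorem piq_shift_alpha (hq : 1 < q) (hqM : q ≤ M + 1) (n : ℕ) :
    piq q (shift n (alpha M q)) ∈ Set.Ioc (0 : ℝ) 1 := by
  obtain ⟨a, ha, h⟩ := exists_tails_mem hq hqM
  rw [alpha_eq_of_tails hq ha h]
  exact h n

/-- Sequences that are at least `α(q)` have value at least `1`. -/
theorem one_le_piq_of_alpha_le (hq : 1 < q) (hqM : q ≤ M + 1) {x : Omega M}
    (h : toLex (alpha M q) ≤ toLex x) : 1 ≤ piq q x := by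
  rcases h.eq_or_lt with h | h
  · rw [← toLex.injective h, piq_alpha hq hqM]
  · obtain ⟨n, h1, h2⟩ := lex_lt_iff.1 h
    have h3 := piq_sub_of_agree_digit hq h1
    rw [piq_alpha hq hqM] at h3
    have h4 := (piq_shift_alpha hq hqM (n + 1)).2
    have h5 := piq_nonneg hq (shift (n + 1) x)
    have h6 : ((alpha M q n : ℕ) : ℝ) + 1 ≤ (x n : ℕ) := by exact_mod_cast h2
    have h7 : 1 - piq q x ≤ 0 := by
      rw [h3]
      exact div_nonpos_of_nonpos_of_nonneg (by linarith) (by positivity)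
    linarith

theorem piq_lt_piq_of_lt {p : ℝ} (hp : 1 < p) (hpq : p < q) {x : Omega M} (h : 0 < piq p x) :
    piq q x < piq p x := by
  have hne : ∃ n, x n ≠ 0 := by
    by_contra hcon
    push Not at hcon
    simp [piq, hcon] at h
  obtain ⟨n, hn⟩ := hne
  have hn' : 0 < (x n : ℕ) := Nat.pos_of_ne_zero fun h' => hn (Fin.ext h')
  refine (summable_piq (hp.trans hpq) x).tsum_lt_tsum (i := n) (fun i => ?_) ?_
    (summable_piq hp x)
  · dsimp only
    gcongr
  · have : p ^ (n + 1) < q ^ (n + 1) := pow_lt_pow_left₀ hpq (by linarith) (by omega)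
    have : 0 < p ^ (n + 1) := by positivity
    gcongr

/-- If `α(q) ≼ α(p)`, then `1 ≤ π_q(α(p)) < π_p(α(p)) = 1`. -/
theorem alpha_strictMono {p : ℝ} (hp : 1 < p) (hpq : p < q) (hqM : q ≤ M + 1) :
    toLex (alpha M p) < toLex (alpha M q) := by
  by_contra h
  have h1 := one_le_piq_of_alpha_le (hp.trans hpq) hqM (not_lt.1 h)
  have h2 := piq_alpha hp (hpq.le.trans hqM)
  have := piq_lt_piq_of_lt hp hpq (x := alpha M p) (by rw [h2]; exact one_pos)
  linarith

/-- If all tails of `x` are at most `s`, where `s` represents `1` and has positive tails, then a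
tail that is smaller than `s` has value less than `1`. -/
theorem piq_shift_lt_one (hq : 1 < q) {s x : Omega M} (hs : piq q s = 1)
    (hpos : ∀ n, 0 < piq q (shift n s)) (h : ∀ n, toLex (shift n x) ≤ toLex s) {m : ℕ}
    (hm : toLex (shift m x) < toLex s) : piq q (shift m x) < 1 := by
  have h0 : 0 < q := by linarith
  -- A uniform bound `1 + C` improves to `1 + C / q`. Iteration from `C = M / (q - 1)` gives the
  -- bound 1, and a last application with `C = 0` gives strictness.
  have key : ∀ C, 0 ≤ C → (∀ n, piq q (shift n x) ≤ 1 + C) → ∀ n,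
      toLex (shift n x) < toLex s → piq q (shift n x) < 1 + C / q := by
    intro C hC hb n hn
    obtain ⟨j, h1, h2⟩ := lex_lt_iff.1 hn
    have h3 := piq_sub_of_agree_digit hq h1
    rw [hs, shift_shift] at h3
    have h4 := hb (j + 1 + n)
    have h5 := hpos (j + 1)
    have h6 : ((shift n x j : ℕ) : ℝ) + 1 ≤ (s j : ℕ) := by exact_mod_cast h2
    have h7 : piq q (shift n x) - 1 < C / q ^ (j + 1) := by
      rw [h3]
      gcongr
      linarith
    have h8 : C / q ^ (j + 1) ≤ C / q := by
      gcongr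
      exact le_self_pow₀ hq.le (by omega)
    linarith
  have iter : ∀ N n, piq q (shift n x) ≤ 1 + (M / (q - 1)) / q ^ N := by
    intro N
    have hM : 0 ≤ M / (q - 1) := div_nonneg (by positivity) (by linarith)
    induction N with
    | zero =>
      intro n
      have := piq_le hq (shift n x)
      simp only [pow_zero, div_one]
      linarith
    | succ N ih =>
      intro n
      rcases (h n).eq_or_lt with h' | h'
      · rw [toLex.injective h', hs]
        have : 0 ≤ M / (q - 1) / q ^ (N + 1) := by positivity
        linarith
      · have := (key _ (by positivity) ih n h').le
        rwa [div_div, ← pow_succ] at this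
  have hle : ∀ n, piq q (shift n x) ≤ 1 + 0 := by
    intro n
    have hlim : Tendsto (fun N : ℕ => 1 + (M / (q - 1)) * (1 / q) ^ N) atTop (𝓝 (1 + 0)) := by
      have := ((tendsto_pow_atTop_nhds_zero_of_lt_one (r := 1 / q) (by positivity)
        (by rw [div_lt_one h0]; exact hq)).const_mul (M / (q - 1))).const_add 1
      simpa using this
    refine ge_of_tendsto' hlim fun N => ?_
    have := iter N n
    rwa [one_div, inv_pow, ← div_eq_mul_inv]
  simpa using key 0 le_rfl hle m hm

/-- A sequence not ending with `0^∞` represents `1` in some base `q ∈ (1, M + 1]`. -/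
theorem exists_base (hM : 1 ≤ M) {s : Omega M} (hs : ¬ ∃ N, ∀ i, N ≤ i → s i = 0) :
    ∃ q : ℝ, 1 < q ∧ q ≤ M + 1 ∧ piq q s = 1 := by
  have hM' : (1 : ℝ) ≤ M := by exact_mod_cast hM
  have hs' := hs
  push Not at hs'
  obtain ⟨i, -, hi⟩ := hs' 0
  obtain ⟨j, hij, hj⟩ := hs' (i + 1)
  -- In a base this close to 1, each of the two nonzero digits at `i < j` contributes more than
  -- `1/2`. In base `M + 1` the value is at most 1, so the intermediate value theorem applies.
  have hev : ∀ᶠ p : ℝ in 𝓝[>] 1, p ^ (j + 1) < 2 :=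
    (((continuous_pow (j + 1)).tendsto' (1 : ℝ) 1 (by simp)).eventually_lt_const
      (by norm_num : (1 : ℝ) < 2)).filter_mono nhdsWithin_le_nhds
  have hev2 : ∀ᶠ p : ℝ in 𝓝[>] 1, p ∈ Set.Ioo (1 : ℝ) (M + 1) :=
    Ioo_mem_nhdsGT (by linarith)
  obtain ⟨p, hp, hp1, hpM⟩ := (hev.and hev2).exists
  have hdig : ∀ n, s n ≠ 0 → (1 : ℝ) ≤ (s n : ℕ) := fun n hn => by
    exact_mod_cast Nat.pos_of_ne_zero fun h' => hn (Fin.ext h')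
  have hp_ge : 1 ≤ piq p s := by
    have h1 : ∑ n ∈ {i, j}, ((s n : ℕ) : ℝ) / p ^ (n + 1) ≤ piq p s :=
      (summable_piq hp1 s).sum_le_tsum _ fun n _ => by positivity
    rw [Finset.sum_pair (by omega)] at h1
    have h0 : 0 < p := by linarith
    have h2 : 1 / p ^ (j + 1) ≤ ((s i : ℕ) : ℝ) / p ^ (i + 1) := by
      have := hdig i hi
      gcongr
      · exact hp1.le
      · omega
    have h3 : 1 / p ^ (j + 1) ≤ ((s j : ℕ) : ℝ) / p ^ (j + 1) := by
      have := hdig j hj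
      gcongr
    have h4 : 1 / 2 < 1 / p ^ (j + 1) := by
      have : 0 < p ^ (j + 1) := by positivity
      gcongr
    linarith
  have hM_le : piq (M + 1 : ℝ) s ≤ 1 := by
    refine (piq_le (by linarith) s).trans ?_
    rw [add_sub_cancel_right, div_self (by linarith)]
  have hcont : ContinuousOn (fun r : ℝ => piq r s) (Set.Icc p (M + 1)) := by
    have hsum := (hasSum_geometric_tail hp1 M).summable
    refine continuousOn_tsum (fun n => ?_) hsum fun n r hr => ?_
    · refine ContinuousOn.div continuousOn_const (continuousOn_pow _) fun r hr => ?_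
      have : 0 < r := by linarith [hr.1]
      positivity
    · have h0 : 0 < p := by linarith
      have h1 : 0 < r := by linarith [hr.1]
      rw [Real.norm_of_nonneg (by positivity)]
      have h2 : ((s n : ℕ) : ℝ) ≤ M := by exact_mod_cast Nat.lt_succ_iff.1 (s n).isLt
      have h3 := hr.1
      gcongr
  obtain ⟨r, hr, hr1⟩ := intermediate_value_Icc' hpM.le hcont ⟨hM_le, hp_ge⟩
  exact ⟨r, hp1.trans_le hr.1, hr.2, hr1⟩

/-- The sequences `s` with `σⁿ s ≼ s` for all `n`, not ending with `0^∞`, are in the range of `α`. -/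
theorem exists_alpha_eq (hM : 1 ≤ M) {s : Omega M} (hs : ¬ ∃ N, ∀ i, N ≤ i → s i = 0)
    (h : ∀ n, toLex (shift n s) ≤ toLex s) :
    ∃ q : ℝ, 1 < q ∧ q ≤ M + 1 ∧ alpha M q = s := by
  obtain ⟨q, hq, hqM, hqs⟩ := exists_base hM hs
  refine ⟨q, hq, hqM, alpha_eq_of_tails hq hqs fun n => ⟨piq_shift_pos hq hs n, ?_⟩⟩
  rcases (h n).eq_or_lt with h' | h'
  · rw [toLex.injective h', hqs]
  · exact (piq_shift_lt_one hq hqs (piq_shift_pos hq hs) h h').le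

theorem baseOf_spec (hM : 1 ≤ M) {s : Omega M} (hs : ¬ ∃ N, ∀ i, N ≤ i → s i = 0)
    (h : ∀ n, toLex (shift n s) ≤ toLex s) :
    1 < baseOf s ∧ baseOf s ≤ M + 1 ∧ alpha M (baseOf s) = s :=
  Classical.epsilon_spec (exists_alpha_eq hM hs h)

end QuasiGreedy

/-! ### The lexicographical description of univoque sequences -/

section Univoque

variable {M : ℕ} {q : ℝ}

theorem mem_univoqueSeqs_iff {x : Omega M} :
    x ∈ univoqueSeqs M q ↔ ∀ y : Omega M, piq q y = piq q x → y = x := by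
  constructor
  · rintro ⟨z, -, hz⟩ y hy
    rw [hz y hy, hz x rfl]
  · exact fun h => ⟨x, rfl, fun y hy => h y hy⟩

theorem reflection_mem_univoqueSeqs (hq : 1 < q) {x : Omega M} (hx : x ∈ univoqueSeqs M q) :
    reflection x ∈ univoqueSeqs M q := by
  rw [mem_univoqueSeqs_iff] at hx ⊢
  intro y hy
  rw [← reflection_reflection y]
  congr 1
  refine hx _ ?_
  have h1 := piq_add_reflection hq x
  have h2 := piq_add_reflection hq y
  linarith

theorem reflection_mem_tildeU {x : Omega M} (hx : x ∈ tildeU M q) :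
    reflection x ∈ tildeU M q := fun n => by
  rw [← reflection_shift]
  exact ⟨reflection_lt_reflection.2 (hx n).2, reflection_lt.1 (hx n).1⟩

theorem shift_mem_tildeU {x : Omega M} (hx : x ∈ tildeU M q) (m : ℕ) :
    shift m x ∈ tildeU M q := fun n => by
  rw [shift_shift]
  exact hx _

/-- Otherwise the tail is worth at least 1, and a unit can be carried: raise the digit at `n` by one
and re-expand the rest of the tail, which gives a second expansion. -/
theorem shift_succ_lt_alpha_of_mem_univoqueSeqs (hq : 1 < q) (hqM : q ≤ M + 1) {x : Omega M}
    (hx : x ∈ univoqueSeqs M q) {n : ℕ} (hn : x n ≠ Fin.last M) :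
    toLex (shift (n + 1) x) < toLex (alpha M q) := by
  by_contra hlt
  have h1 := one_le_piq_of_alpha_le hq hqM (not_lt.1 hlt)
  have h2 := piq_le hq (shift (n + 1) x)
  obtain ⟨z, hz⟩ := exists_piq_eq hq hqM (M := M) (v := piq q (shift (n + 1) x) - 1)
    (by linarith) (by linarith)
  have hlast : (x n : ℕ) < M := Fin.val_lt_last hn
  let c : Fin (M + 1) := ⟨x n + 1, by omega⟩
  let y : Omega M := fun i => if i < n then x i else if i = n then c else z (i - (n + 1))
  have hyn : y n = c := by simp [y]
  have hyz : shift (n + 1) y = z := by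
    funext i
    have ha : ¬ i + (n + 1) < n := by omega
    have hb : ¬ i + (n + 1) = n := by omega
    simp [y, shift, ha, hb]
  have h3 := piq_sub_of_agree_digit hq (x := y) (y := x) (n := n) fun i hi => by simp [y, hi]
  rw [hyz, hz, hyn] at h3
  have h4 : piq q y = piq q x := by
    have : ((c : ℕ) : ℝ) = (x n : ℕ) + 1 := by simp [c]
    rw [this] at h3
    rw [← sub_eq_zero, h3]
    ring
  have h5 := (mem_univoqueSeqs_iff.1 hx) y h4
  have h6 : (c : ℕ) = x n := by rw [← hyn, h5]
  simp [c] at h6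

/-- The tails of a univoque sequence after a digit less than `M` are less than `α(q)`. -/
theorem shift_lt_alpha_of_mem_univoqueSeqs (hq : 1 < q) (hqM : q ≤ M + 1) {x : Omega M}
    (hx : x ∈ univoqueSeqs M q) {m : ℕ} (hm : x m ≠ Fin.last M) {n : ℕ} (hn : m < n) :
    toLex (shift n x) < toLex (alpha M q) := by
  induction n, hn using Nat.le_induction with
  | base => exact shift_succ_lt_alpha_of_mem_univoqueSeqs hq hqM hx hm
  | succ n hn ih =>
    by_cases hxn : x n = Fin.last M
    · exact (shift_succ_le_of_last hxn).trans_lt ih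
    · exact shift_succ_lt_alpha_of_mem_univoqueSeqs hq hqM hx hxn

theorem shift_mem_tildeU_of_mem_univoqueSeqs (hq : 1 < q) (hqM : q ≤ M + 1) {x : Omega M}
    (hx : x ∈ univoqueSeqs M q) {j m m' : ℕ} (hm : x m ≠ Fin.last M) (hm' : x m' ≠ 0)
    (hmj : m ≤ j) (hmj' : m' ≤ j) : shift (j + 1) x ∈ tildeU M q := fun n => by
  rw [shift_shift]
  refine ⟨?_, shift_lt_alpha_of_mem_univoqueSeqs hq hqM hx hm (by omega)⟩
  rw [reflection_lt, reflection_shift]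
  refine shift_lt_alpha_of_mem_univoqueSeqs hq hqM (reflection_mem_univoqueSeqs hq hx)
    (m := m') (fun h => hm' ?_) (by omega)
  rw [← Fin.rev_inj, Fin.rev_zero]
  exact h

/-- Both bounds hold once a digit other than `M` and a digit other than `0` have occurred, that is,
strictly after an initial run of zeros or of `M`s has been broken. The breaking digit at `j` itself
is lost, hence `j + 1`. -/
theorem exists_shift_mem_tildeU (hM : 1 ≤ M) (hq : 1 < q) (hqM : q ≤ M + 1) {x : Omega M}
    (hx : x ∈ univoqueSeqs M q) :
    ∃ d, (∀ i, x i = d) ∨ ∃ j, (∀ i < j, x i = d) ∧ shift (j + 1) x ∈ tildeU M q := by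
  classical
  refine ⟨x 0, ?_⟩
  by_cases hc : ∀ i, x i = x 0
  · exact Or.inl hc
  right
  push Not at hc
  by_cases h0 : x 0 = 0
  · refine ⟨Nat.find hc, fun i hi => not_not.1 (Nat.find_min hc hi), ?_⟩
    have h1 := Nat.find_spec hc
    refine shift_mem_tildeU_of_mem_univoqueSeqs hq hqM hx (m := 0) (m' := Nat.find hc) ?_ ?_
      (Nat.zero_le _) le_rfl
    · intro h
      have := congrArg Fin.val (h0.symm.trans h)
      simp at this
      omega
    · exact fun h => h1 (h.trans h0.symm)
  · by_cases hl : x 0 = Fin.last M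
    · refine ⟨Nat.find hc, fun i hi => not_not.1 (Nat.find_min hc hi), ?_⟩
      have h1 := Nat.find_spec hc
      refine shift_mem_tildeU_of_mem_univoqueSeqs hq hqM hx (m := Nat.find hc) (m' := 0) ?_ h0
        le_rfl (Nat.zero_le _)
      exact fun h => h1 (h.trans hl.symm)
    · exact ⟨0, by simp, shift_mem_tildeU_of_mem_univoqueSeqs hq hqM hx hl h0 le_rfl le_rfl⟩

/-- The tails of `x` are worth less than 1, so they cannot compensate for a digit of `y` that is
larger by at least one. -/
theorem digit_le_of_mem_tildeU (hq : 1 < q) (hqM : q ≤ M + 1) {x y : Omega M}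
    (hx : ∀ n, toLex (shift n x) < toLex (alpha M q)) (hxy : piq q y = piq q x) {n : ℕ}
    (hn : ∀ i < n, y i = x i) : y n ≤ x n := by
  by_contra hlt
  have h1 := piq_sub_of_agree_digit hq hn
  rw [hxy, sub_self, eq_comm, div_eq_zero_iff] at h1
  have h2 := piq_shift_lt_one hq (piq_alpha hq hqM) (fun n => (piq_shift_alpha hq hqM n).1)
    (fun n => (hx n).le) (hx (n + 1))
  have h3 := piq_nonneg hq (shift (n + 1) y)
  have h4 : ((x n : ℕ) : ℝ) + 1 ≤ (y n : ℕ) := by exact_mod_cast not_le.1 hlt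
  have h5 : 0 < q ^ (n + 1) := by positivity
  rcases h1 with h1 | h1 <;> linarith

theorem tildeU_subset_univoqueSeqs (hq : 1 < q) (hqM : q ≤ M + 1) :
    tildeU M q ⊆ univoqueSeqs M q := by
  intro x hx
  rw [mem_univoqueSeqs_iff]
  intro y hxy
  funext n
  induction n using Nat.strong_induction_on with
  | _ n ih =>
    refine le_antisymm (digit_le_of_mem_tildeU hq hqM (fun n => (hx n).2) hxy ih) ?_
    have h1 := piq_add_reflection hq x
    have h2 := piq_add_reflection hq y
    rw [← Fin.rev_le_rev]
    exact digit_le_of_mem_tildeU hq hqM (x := reflection x) (y := reflection y)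
      (fun n => ((reflection_mem_tildeU hx) n).2) (by linarith)
      (fun i hi => congrArg Fin.rev (ih i hi))

end Univoque

end Univoque

namespace Univoque

/-! ### The block code -/

section Code

/-- The state before the `i`-th step of the walk with states `s, y 0, y 1, …`. -/
def prevDigit (s : Fin 2) (y : Omega 1) : ℕ → Fin 2
  | 0 => s
  | i + 1 => y i

/-- The sequence of block labels of the walk in the graph that is at `A` when its state is `1`, at
`B` (or the start) when its state is `0`, and has the states `s, y 0, y 1, …`. -/
def code (M : ℕ) (s : Fin 2) (y : Omega 1) : Omega M := fun i =>
  if Even M then Fin.ofNat (M + 1) (M / 2 + y i - prevDigit s y i)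
  else if Even i then Fin.ofNat (M + 1) (M / 2 + 1 - prevDigit s y (i / 2))
  else Fin.ofNat (M + 1) (M / 2 + y (i / 2))

/-- The assumption gives `k ≥ 1`, so `k - 1` and `k + 1` are digits: neither the truncated
subtraction nor `Fin.ofNat` interferes. The additive form suits linear arithmetic. -/
theorem code_even {k : ℕ} (hk : 1 ≤ 2 * k) (s : Fin 2) (y : Omega 1) (i : ℕ) :
    (code (2 * k) s y i : ℕ) + prevDigit s y i = k + y i := by
  have h1 := (prevDigit s y i).isLt
  have h2 := (y i).isLt
  simp only [code, even_two_mul, if_true, Fin.ofNat]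
  rw [Nat.mod_eq_of_lt (by omega)]
  omega

theorem code_odd_fst {k : ℕ} (s : Fin 2) (y : Omega 1) (i : ℕ) :
    (code (2 * k + 1) s y (2 * i) : ℕ) + prevDigit s y i = k + 1 := by
  have h1 := (prevDigit s y i).isLt
  have h3 : ¬ Even (2 * k + 1) := by simp
  have h4 : 2 * i / 2 = i := by omega
  simp only [code, if_neg h3, even_two_mul, if_true, Fin.ofNat, h4]
  rw [Nat.mod_eq_of_lt (by omega)]
  omega

theorem code_odd_snd {k : ℕ} (s : Fin 2) (y : Omega 1) (i : ℕ) :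
    (code (2 * k + 1) s y (2 * i + 1) : ℕ) = k + y i := by
  have h1 := (y i).isLt
  have h3 : ¬ Even (2 * k + 1) := by simp
  have h4 : (2 * i + 1) / 2 = i := by omega
  have h5 : ¬ Even (2 * i + 1) := by simp
  simp only [code, if_neg h3, if_neg h5, Fin.ofNat, h4]
  rw [Nat.mod_eq_of_lt (by omega)]
  omega

theorem unitLift_even (k : ℕ) : unitLift (2 * k) = [Fin.ofNat (2 * k + 1) k] := by
  simp [unitLift]

theorem unitLift_odd (k : ℕ) : unitLift (2 * k + 1) =
    [Fin.ofNat (2 * k + 1 + 1) (k + 1), Fin.ofNat (2 * k + 1 + 1) k] := by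
  have h3 : ¬ Even (2 * k + 1) := by simp
  have h4 : (2 * k + 1) / 2 = k := by omega
  simp [unitLift, h3, h4]

theorem unitLift_length_even (k : ℕ) : (unitLift (2 * k)).length = 1 := by
  rw [unitLift_even]; rfl

theorem unitLift_length_odd (k : ℕ) : (unitLift (2 * k + 1)).length = 2 := by
  rw [unitLift_odd]; rfl

theorem unitLift_length_pos (M : ℕ) : 0 < (unitLift M).length := by
  rcases Nat.even_or_odd' M with ⟨k, rfl | rfl⟩
  · rw [unitLift_length_even]; omega
  · rw [unitLift_length_odd]; omega

theorem cConst_eq (M : ℕ) : cConst M = 1 / ((unitLift M).length : ℝ) := by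
  rcases Nat.even_or_odd' M with ⟨k, rfl | rfl⟩
  · rw [unitLift_length_even]; simp [cConst]
  · rw [unitLift_length_odd]
    have h3 : ¬ Even (2 * k + 1) := by simp
    simp [cConst, h3]

variable {M : ℕ}

theorem prevDigit_shift (s : Fin 2) (y : Omega 1) (n i : ℕ) :
    prevDigit (prevDigit s y n) (shift n y) i = prevDigit s y (i + n) := by
  cases i with
  | zero => simp [prevDigit]
  | succ i => rw [add_right_comm]; rfl

theorem prevDigit_reflection (s : Fin 2) (y : Omega 1) (i : ℕ) :
    prevDigit (Fin.rev s) (reflection y) i = Fin.rev (prevDigit s y i) := by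
  cases i <;> rfl

theorem prevDigit_congr {s : Fin 2} {y z : Omega 1} {n : ℕ} (h : ∀ i < n, y i = z i) {i : ℕ}
    (hi : i ≤ n) : prevDigit s y i = prevDigit s z i := by
  cases i with
  | zero => rfl
  | succ i => exact h i (by omega)

theorem shift_code (hM : 1 ≤ M) (s : Fin 2) (y : Omega 1) (n : ℕ) :
    shift ((unitLift M).length * n) (code M s y) = code M (prevDigit s y n) (shift n y) := by
  rcases Nat.even_or_odd' M with ⟨k, rfl | rfl⟩
  · rw [unitLift_length_even, one_mul]
    funext i
    apply Fin.ext
    have h1 := code_even hM s y (i + n)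
    have h2 := code_even hM (prevDigit s y n) (shift n y) i
    rw [prevDigit_shift] at h2
    simp only [shift] at h2 ⊢
    omega
  · rw [unitLift_length_odd]
    funext i
    apply Fin.ext
    rcases Nat.even_or_odd' i with ⟨j, rfl | rfl⟩
    · have h1 := code_odd_fst (k := k) s y (j + n)
      have h2 := code_odd_fst (k := k) (prevDigit s y n) (shift n y) j
      rw [prevDigit_shift] at h2
      simp only [shift]
      rw [← mul_add]
      omega
    · have h1 := code_odd_snd (k := k) s y (j + n)
      have h2 := code_odd_snd (k := k) (prevDigit s y n) (shift n y) j
      simp only [shift] at h2 ⊢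
      rw [show 2 * j + 1 + 2 * n = 2 * (j + n) + 1 by ring]
      omega

theorem reflection_code (hM : 1 ≤ M) (s : Fin 2) (y : Omega 1) :
    reflection (code M s y) = code M (Fin.rev s) (reflection y) := by
  funext i
  apply Fin.ext
  have h0 := reflection_val (code M s y) i
  rcases Nat.even_or_odd' M with ⟨k, rfl | rfl⟩
  · have h1 := code_even hM s y i
    have h2 := code_even hM (Fin.rev s) (reflection y) i
    have h3 := reflection_val y i
    have h4 := Fin.val_rev (prevDigit s y i)
    rw [prevDigit_reflection] at h2
    omega
  · rcases Nat.even_or_odd' i with ⟨j, rfl | rfl⟩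
    · have h1 := code_odd_fst (k := k) s y j
      have h2 := code_odd_fst (k := k) (Fin.rev s) (reflection y) j
      have h4 := Fin.val_rev (prevDigit s y j)
      rw [prevDigit_reflection] at h2
      omega
    · have h1 := code_odd_snd (k := k) s y j
      have h2 := code_odd_snd (k := k) (Fin.rev s) (reflection y) j
      have h3 := reflection_val y j
      omega

/-- Given the preceding state, the last digit of a block determines the next state. Besides
injectivity, this yields the equality of word counts in the entropy formula. -/
theorem code_agree_iff (hM : 1 ≤ M) (s : Fin 2) (y z : Omega 1) (n : ℕ) :
    (∀ i < (unitLift M).length * n, code M s y i = code M s z i) ↔ ∀ i < n, y i = z i := by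
  constructor
  · intro h i
    induction i using Nat.strong_induction_on with
    | _ i ih =>
      intro hi
      have hp : prevDigit s y i = prevDigit s z i :=
        prevDigit_congr (fun j hj => ih j hj (hj.trans hi)) le_rfl
      apply Fin.ext
      rcases Nat.even_or_odd' M with ⟨k, rfl | rfl⟩
      · rw [unitLift_length_even, one_mul] at h
        have h1 := code_even hM s y i
        have h2 := code_even hM s z i
        rw [h i hi, hp] at h1
        omega
      · rw [unitLift_length_odd] at h
        have h1 := code_odd_snd (k := k) s y i
        have h2 := code_odd_snd (k := k) s z i
        rw [h (2 * i + 1) (by omega)] at h1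
        omega
  · intro h i hi
    apply Fin.ext
    rcases Nat.even_or_odd' M with ⟨k, rfl | rfl⟩
    · rw [unitLift_length_even, one_mul] at hi
      have h1 := code_even hM s y i
      have h2 := code_even hM s z i
      rw [h i hi, prevDigit_congr h hi.le] at h1
      omega
    · rw [unitLift_length_odd] at hi
      rcases Nat.even_or_odd' i with ⟨j, rfl | rfl⟩
      · have h1 := code_odd_fst (k := k) s y j
        have h2 := code_odd_fst (k := k) s z j
        rw [prevDigit_congr h (by omega)] at h1
        omega
      · rw [code_odd_snd (k := k), code_odd_snd (k := k), h j (by omega)]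

/-- At the first difference the preceding states agree, so the last digit of that block decides; for
odd `M` the first digit of the block depends on the preceding state only. -/
theorem code_strictMono (hM : 1 ≤ M) (s : Fin 2) {y z : Omega 1} (h : toLex y < toLex z) :
    toLex (code M s y) < toLex (code M s z) := by
  obtain ⟨n, h1, h2⟩ := lex_lt_iff.1 h
  have h3 := (code_agree_iff hM s y z n).2 h1
  have hp : prevDigit s y n = prevDigit s z n := prevDigit_congr h1 le_rfl
  rw [Fin.lt_def] at h2
  rw [lex_lt_iff]
  rcases Nat.even_or_odd' M with ⟨k, rfl | rfl⟩
  · rw [unitLift_length_even, one_mul] at h3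
    refine ⟨n, h3, ?_⟩
    have h4 := code_even hM s y n
    have h5 := code_even hM s z n
    rw [hp] at h4
    rw [Fin.lt_def]
    omega
  · rw [unitLift_length_odd] at h3
    refine ⟨2 * n + 1, fun i hi => ?_, ?_⟩
    · rcases Nat.lt_succ_iff_lt_or_eq.1 hi with hi | rfl
      · exact h3 i hi
      · have h4 := code_odd_fst (k := k) s y n
        have h5 := code_odd_fst (k := k) s z n
        rw [hp] at h4
        apply Fin.ext
        omega
    · rw [Fin.lt_def, code_odd_snd, code_odd_snd]
      omega

theorem code_lt_iff (hM : 1 ≤ M) (s : Fin 2) {y z : Omega 1} :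
    toLex (code M s y) < toLex (code M s z) ↔ toLex y < toLex z :=
  (show StrictMono fun y : Lex (Omega 1) => toLex (code M s (ofLex y)) from
    fun _ _ h => code_strictMono hM s h).lt_iff_lt

theorem code_le_iff (hM : 1 ≤ M) (s : Fin 2) {y z : Omega 1} :
    toLex (code M s y) ≤ toLex (code M s z) ↔ toLex y ≤ toLex z :=
  (show StrictMono fun y : Lex (Omega 1) => toLex (code M s (ofLex y)) from
    fun _ _ h => code_strictMono hM s h).le_iff_le

theorem code_injective (hM : 1 ≤ M) (s : Fin 2) : Function.Injective (code M s) := by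
  intro y z h
  funext i
  exact (code_agree_iff hM s y z (i + 1)).1 (fun j _ => congrFun h j) i (by omega)

/-- A block leaving state 1 begins with a digit at most `k`, whereas `𝐮⁺` begins with `k + 1`. -/
theorem code_one_lt_code_zero (hM : 1 ≤ M) (y : Omega 1) {z : Omega 1} (hz : z 0 = 1) :
    toLex (code M 1 y) < toLex (code M 0 z) := by
  rw [lex_lt_iff]
  refine ⟨0, by simp, ?_⟩
  rw [Fin.lt_def]
  have hz' : (z 0 : ℕ) = 1 := by rw [hz]; rfl
  rcases Nat.even_or_odd' M with ⟨k, rfl | rfl⟩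
  · have h1 := code_even hM 1 y 0
    have h2 := code_even hM 0 z 0
    have h3 := (y 0).isLt
    simp only [prevDigit, Fin.isValue, Fin.val_one, Fin.val_zero] at h1 h2
    omega
  · have h1 := code_odd_fst (k := k) 1 y 0
    have h2 := code_odd_fst (k := k) 0 z 0
    simp only [prevDigit, Fin.isValue, Fin.val_one, Fin.val_zero, mul_zero] at h1 h2
    omega

/-- Tails that begin within a block are small. -/
theorem shift_code_lt (hM : 1 ≤ M) (s : Fin 2) (y : Omega 1) {z : Omega 1} (hz : z 0 = 1) {n : ℕ}
    (hn : ¬ (unitLift M).length ∣ n) : toLex (shift n (code M s y)) < toLex (code M 0 z) := by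
  rcases Nat.even_or_odd' M with ⟨k, rfl | rfl⟩
  · simp [unitLift_length_even] at hn
  · rw [unitLift_length_odd] at hn
    obtain ⟨m, rfl⟩ : ∃ m, n = 2 * m + 1 := ⟨n / 2, by omega⟩
    have hz' : (z 0 : ℕ) = 1 := by rw [hz]; rfl
    have h1 := code_odd_snd (k := k) s y m
    have h2 := code_odd_fst (k := k) s y (m + 1)
    have h3 := code_odd_fst (k := k) 0 z 0
    have h4 := code_odd_snd (k := k) 0 z 0
    have h5 : (prevDigit s y (m + 1)) = y m := rfl
    have h6 : shift (2 * m + 1) (code (2 * k + 1) s y) 0 = code (2 * k + 1) s y (2 * m + 1) := by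
      simp [shift]
    have h7 : shift (2 * m + 1) (code (2 * k + 1) s y) 1 =
        code (2 * k + 1) s y (2 * (m + 1)) := by
      simp only [shift]
      congr 1
      omega
    have h8 := (y m).isLt
    simp only [prevDigit, Fin.isValue, Fin.val_zero, mul_zero] at h3 h4
    rw [h5] at h2
    rw [lex_lt_iff]
    -- The tail starts with `k + y m`. If `y m = 1`, the next digit is `k`, below the second digit
    -- `k + 1` of `𝐮⁺`.
    by_cases hy : (y m : ℕ) = 0
    · refine ⟨0, by simp, ?_⟩
      rw [h6, Fin.lt_def]
      omega
    · refine ⟨1, ?_, ?_⟩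
      · intro i hi
        obtain rfl : i = 0 := by omega
        apply Fin.ext
        rw [h6]
        omega
      · rw [h7, Fin.lt_def]
        simp only [zero_add] at h4
        omega

theorem initialWord_eq_plus_even {k : ℕ} (hk : 1 ≤ 2 * k) {x : Omega (2 * k)} :
    initialWord (unitLift (2 * k)).length x = (unitLift (2 * k)).plus ↔ (x 0 : ℕ) = k + 1 := by
  rw [unitLift_length_even, unitLift_even]
  have : ((Fin.ofNat (2 * k + 1) k + 1 : Fin (2 * k + 1)) : ℕ) = k + 1 := by
    rw [Fin.val_add, Fin.val_one', Fin.val_ofNat, Nat.mod_eq_of_lt (a := k) (by omega),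
      Nat.mod_eq_of_lt (a := 1) (by omega), Nat.mod_eq_of_lt (by omega)]
  have hx : initialWord 1 x = [x 0] := by simp [initialWord]
  simp only [hx, Word.plus, List.cons.injEq, and_true, Fin.ext_iff, this]

theorem initialWord_eq_plus_odd {k : ℕ} {x : Omega (2 * k + 1)} :
    initialWord (unitLift (2 * k + 1)).length x = (unitLift (2 * k + 1)).plus ↔
      (x 0 : ℕ) = k + 1 ∧ (x 1 : ℕ) = k + 1 := by
  rw [unitLift_length_odd, unitLift_odd]
  have : ((Fin.ofNat (2 * k + 1 + 1) k + 1 : Fin (2 * k + 1 + 1)) : ℕ) = k + 1 := by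
    rw [Fin.val_add, Fin.val_one', Fin.val_ofNat, Nat.mod_eq_of_lt (a := k) (by omega),
      Nat.mod_eq_of_lt (a := 1) (by omega), Nat.mod_eq_of_lt (by omega)]
  have h2 : ((Fin.ofNat (2 * k + 1 + 1) (k + 1) : Fin (2 * k + 1 + 1)) : ℕ) = k + 1 := by
    rw [Fin.val_ofNat, Nat.mod_eq_of_lt (by omega)]
  have hx : initialWord 2 x = [x 0, x 1] := by simp [initialWord]
  simp only [hx, Word.plus, List.cons.injEq, and_true, Fin.ext_iff, this, h2]

theorem initialWord_code (hM : 1 ≤ M) (y : Omega 1) :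
    initialWord (unitLift M).length (code M 0 y) = (unitLift M).plus ↔ y 0 = 1 := by
  rw [Fin.ext_iff, show ((1 : Fin 2) : ℕ) = 1 from rfl]
  rcases Nat.even_or_odd' M with ⟨k, rfl | rfl⟩
  · rw [initialWord_eq_plus_even hM]
    have h1 := code_even hM 0 y 0
    simp only [prevDigit, Fin.isValue, Fin.val_zero] at h1
    omega
  · rw [initialWord_eq_plus_odd]
    have h1 := code_odd_fst (k := k) 0 y 0
    have h2 := code_odd_snd (k := k) 0 y 0
    simp only [prevDigit, Fin.isValue, Fin.val_zero, mul_zero, zero_add] at h1 h2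
    omega

end Code

end Univoque

namespace Univoque

/-! ### Paths in the graph and the block map -/

section Paths

variable {M : ℕ}

/-- The state from which an edge leaves. -/
def Edge.state : Edge → Fin 2
  | .e0 => 0
  | .e1 => 1
  | .e2 => 0
  | .e3 => 0
  | .e4 => 1

/-- The edge taken from state `s` to state `t`, after the start. -/
def edgeOf (s t : Fin 2) : Edge :=
  if s = 1 then (if t = 1 then .e4 else .e1) else (if t = 1 then .e3 else .e2)

/-- The edges labelled 1 are exactly those entering A. -/
theorem Edge.state_eq_of_tgt {e f : Edge} (h : e.tgt = f.src) : f.state = starLabel e := by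
  cases e <;> cases f <;> simp_all [Edge.tgt, Edge.src, Edge.state, starLabel]

theorem IsPath.state_eq {e : ℕ → Edge} (h : IsPath e) (i : ℕ) :
    (e i).state = prevDigit 0 (fun j => starLabel (e j)) i := by
  cases i with
  | zero =>
    have := h.1
    revert this
    cases e 0 <;> simp [Edge.src, Edge.state, prevDigit]
  | succ i => exact Edge.state_eq_of_tgt (h.2 i)

theorem val_ofNat_add_one {N k : ℕ} (h : k + 1 < N + 1) :
    ((Fin.ofNat (N + 1) k + 1 : Fin (N + 1)) : ℕ) = k + 1 := by
  rw [Fin.val_add, Fin.val_one', Fin.val_ofNat, Nat.mod_eq_of_lt (a := k) (by omega),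
    Nat.mod_eq_of_lt (a := 1) (by omega), Nat.mod_eq_of_lt (by omega)]

theorem blockLabel_even {k : ℕ} (hk : 1 ≤ 2 * k) (e : Edge) :
    ((blockLabel (unitLift (2 * k)) e).getD 0 0 : ℕ) + e.state = k + starLabel e := by
  have h1 := val_ofNat_add_one (N := 2 * k) (k := k) (by omega)
  have h2 : (Fin.ofNat (2 * k + 1) k : ℕ) = k := Nat.mod_eq_of_lt (by omega)
  rw [unitLift_even]
  cases e <;>
    simp only [blockLabel, Word.plus, Word.reflection, List.map_cons, List.getD_cons_zero,
      Fin.val_rev, h1, h2, Edge.state, starLabel, Fin.isValue, Fin.val_zero, Fin.val_one] <;>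
    omega

theorem blockLabel_odd {k : ℕ} (e : Edge) :
    ((blockLabel (unitLift (2 * k + 1)) e).getD 0 0 : ℕ) + e.state = k + 1 ∧
      ((blockLabel (unitLift (2 * k + 1)) e).getD 1 0 : ℕ) = k + starLabel e := by
  have h1 := val_ofNat_add_one (N := 2 * k + 1) (k := k) (by omega)
  have h2 : (Fin.ofNat (2 * k + 1 + 1) k : ℕ) = k := Nat.mod_eq_of_lt (by omega)
  have h3 : (Fin.ofNat (2 * k + 1 + 1) (k + 1) : ℕ) = k + 1 := Nat.mod_eq_of_lt (by omega)
  rw [unitLift_odd]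
  cases e <;>
    simp only [blockLabel, Word.plus, Word.reflection, List.map_cons, List.getD_cons_zero,
      List.getD_cons_succ, Fin.val_rev, h1, h2, h3, Edge.state, starLabel, Fin.isValue,
      Fin.val_zero, Fin.val_one] <;>
    clear h1 h2 h3 <;> constructor <;> first | trivial | omega

theorem concat_blockLabel (hM : 1 ≤ M) {e : ℕ → Edge} (h : IsPath e) :
    concat (unitLift M).length (fun i => blockLabel (unitLift M) (e i)) =
      code M 0 fun i => starLabel (e i) := by
  funext i
  apply Fin.ext
  rcases Nat.even_or_odd' M with ⟨k, rfl | rfl⟩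
  · have h1 := blockLabel_even hM (e i)
    have h2 := code_even hM 0 (fun i => starLabel (e i)) i
    rw [h.state_eq] at h1
    rw [unitLift_length_even]
    simp only [concat, Nat.div_one, Nat.mod_one]
    omega
  · rw [unitLift_length_odd]
    rcases Nat.even_or_odd' i with ⟨j, rfl | rfl⟩
    · have h1 := (blockLabel_odd (k := k) (e j)).1
      have h2 := code_odd_fst (k := k) 0 (fun i => starLabel (e i)) j
      rw [h.state_eq] at h1
      simp only [concat]
      rw [show 2 * j / 2 = j by omega, show 2 * j % 2 = 0 by omega]
      omega
    · have h1 := (blockLabel_odd (k := k) (e j)).2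
      have h2 := code_odd_snd (k := k) 0 (fun i => starLabel (e i)) j
      simp only [concat]
      rw [show (2 * j + 1) / 2 = j by omega, show (2 * j + 1) % 2 = 1 by omega]
      omega

theorem edgeOf_spec (s t u : Fin 2) :
    starLabel (edgeOf s t) = t ∧ (edgeOf s t).tgt = (edgeOf t u).src := by
  fin_cases s <;> fin_cases t <;> fin_cases u <;> exact ⟨rfl, rfl⟩

theorem exists_isPath {y : Omega 1} (hy : y 0 = 1) :
    ∃ e, IsPath e ∧ (fun i => starLabel (e i)) = y := by
  -- The first edge `e0` accounts for `y 0 = 1`; every later edge is determined by two consecutive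
  -- digits.
  refine ⟨fun i => Nat.rec .e0 (fun i _ => edgeOf (y i) (y (i + 1))) i, ⟨rfl, fun i => ?_⟩, ?_⟩
  · cases i with
    | zero =>
      show Edge.tgt .e0 = (edgeOf (y 0) (y 1)).src
      rw [hy]
      exact (edgeOf_spec 1 1 (y 1)).2
    | succ i => exact (edgeOf_spec _ _ _).2
  · funext i
    cases i with
    | zero => exact hy.symm
    | succ i => exact (edgeOf_spec _ _ 0).1

theorem exists_spells (hM : 1 ≤ M) {y : Omega 1} (hy : y 0 = 1) :
    ∃ e, Spells (unitLift M) e (code M 0 y) := by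
  obtain ⟨e, he, rfl⟩ := exists_isPath hy
  exact ⟨e, he, (concat_blockLabel hM he).symm⟩

theorem code_mem_blockSeqs (hM : 1 ≤ M) {y : Omega 1} (hy : y 0 = 1) :
    code M 0 y ∈ blockSeqs (unitLift M) := exists_spells hM hy

/-- The path picked by choice is harmless: its labels have the same code, and the code is injective.
-/
theorem blockMap_code (hM : 1 ≤ M) {y : Omega 1} (hy : y 0 = 1) :
    blockMap (unitLift M) (code M 0 y) = y := by
  have h := exists_spells hM hy
  rw [blockMap, dif_pos h]
  have h1 := h.choose_spec
  exact (code_injective hM 0 (h1.2.trans (concat_blockLabel hM h1.1))).symm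

end Paths

/-! ### The codes of `0^∞` and `1^∞`, and the bases `q_G` and `q_T` -/

section Bounds

variable {M : ℕ}

/-- The constant sequence `1^∞`; its code is `𝐮⁺ (reflection 𝐮)^∞`. -/
def ones : Omega 1 := fun _ => 1

/-- The constant sequence `0^∞`; its code is `𝐮^∞`. -/
def zeros : Omega 1 := fun _ => 0

theorem code_ones_even_zero {k : ℕ} (hk : 1 ≤ 2 * k) : (code (2 * k) 0 ones 0 : ℕ) = k + 1 := by
  have := code_even hk 0 ones 0
  simpa [prevDigit, ones] using this

theorem code_ones_even_succ {k : ℕ} (hk : 1 ≤ 2 * k) (i : ℕ) :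
    (code (2 * k) 0 ones (i + 1) : ℕ) = k := by
  have := code_even hk 0 ones (i + 1)
  simpa [prevDigit, ones] using this

theorem code_ones_odd_zero {k : ℕ} : (code (2 * k + 1) 0 ones 0 : ℕ) = k + 1 := by
  have := code_odd_fst (k := k) 0 ones 0
  simpa [prevDigit, ones] using this

theorem code_ones_odd_even {k : ℕ} (i : ℕ) : (code (2 * k + 1) 0 ones (2 * (i + 1)) : ℕ) = k := by
  have := code_odd_fst (k := k) 0 ones (i + 1)
  simpa [prevDigit, ones] using this

theorem code_ones_odd_odd {k : ℕ} (i : ℕ) : (code (2 * k + 1) 0 ones (2 * i + 1) : ℕ) = k + 1 := by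
  have := code_odd_snd (k := k) 0 ones i
  simpa [prevDigit, ones] using this

theorem code_zeros_even {k : ℕ} (hk : 1 ≤ 2 * k) (i : ℕ) : (code (2 * k) 0 zeros i : ℕ) = k := by
  have := code_even hk 0 zeros i
  cases i <;> simpa [prevDigit, zeros] using this

theorem code_zeros_odd_even {k : ℕ} (i : ℕ) :
    (code (2 * k + 1) 0 zeros (2 * i) : ℕ) = k + 1 := by
  have := code_odd_fst (k := k) 0 zeros i
  cases i <;> simpa [prevDigit, zeros] using this

theorem code_zeros_odd_odd {k : ℕ} (i : ℕ) : (code (2 * k + 1) 0 zeros (2 * i + 1) : ℕ) = k := by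
  have := code_odd_snd (k := k) 0 zeros i
  simpa [prevDigit, zeros] using this

theorem evPeriodic_unitLift (hM : 1 ≤ M) : evPeriodic [] (unitLift M) = code M 0 zeros := by
  funext i
  apply Fin.ext
  rcases Nat.even_or_odd' M with ⟨k, rfl | rfl⟩
  · rw [code_zeros_even hM, unitLift_even]
    simp only [evPeriodic, List.length_nil, Nat.not_lt_zero, if_false, List.length_singleton,
      Nat.mod_one, List.getD_cons_zero, Fin.val_ofNat]
    exact Nat.mod_eq_of_lt (by omega)
  · rw [unitLift_odd]
    simp only [evPeriodic, List.length_nil, Nat.not_lt_zero, if_false, List.length_cons,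
      Nat.sub_zero, zero_add, Nat.reduceAdd]
    rcases Nat.even_or_odd' i with ⟨j, rfl | rfl⟩
    · rw [show 2 * j % 2 = 0 by omega, code_zeros_odd_even]
      simp only [List.getD_cons_zero, Fin.val_ofNat]
      exact Nat.mod_eq_of_lt (by omega)
    · rw [show (2 * j + 1) % 2 = 1 by omega, code_zeros_odd_odd]
      simp only [List.getD_cons_zero, List.getD_cons_succ, Fin.val_ofNat]
      exact Nat.mod_eq_of_lt (by omega)

/-- From `τ₀ = 0` and `τ₁ = τ₂ = 1`, the Thue-Morse definition gives `(k+1) k^∞` for `M = 2k` and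
`(k+1)(k+1) (k(k+1))^∞` for `M = 2k+1`. -/
theorem alphaPrime_one (hM : 1 ≤ M) : alphaPrime M 1 = code M 0 ones := by
  have t0 : tau 0 = 0 := by simp [tau]
  have t1 : tau 1 = 1 := by simp [tau]
  have t2 : tau 2 = 1 := by norm_num [tau]
  funext i
  apply Fin.ext
  rcases Nat.even_or_odd' M with ⟨k, rfl | rfl⟩
  · have hw : lamWord (2 * k) 1 = [Fin.ofNat (2 * k + 1) (k + 1)] := by
      simp [lamWord, lam, t0, t1]
    have hr : (Fin.rev (Fin.ofNat (2 * k + 1) (k + 1)) + 1 : Fin (2 * k + 1)) =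
        Fin.ofNat (2 * k + 1) (k - 1) + 1 := by
      congr 1
      apply Fin.ext
      rw [Fin.val_rev, Fin.val_ofNat, Fin.val_ofNat, Nat.mod_eq_of_lt (by omega),
        Nat.mod_eq_of_lt (by omega)]
      omega
    have hr' := val_ofNat_add_one (N := 2 * k) (k := k - 1) (by omega)
    simp only [alphaPrime, even_two_mul, if_true, Nat.sub_self, pow_zero, hw, evPeriodic,
      Word.reflection, List.map_cons, List.map_nil, Word.plus, List.length_singleton, Nat.mod_one,
      List.getD_cons_zero, hr]
    cases i with
    | zero =>
      rw [code_ones_even_zero hM]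
      simp only [zero_lt_one, if_true, List.getD_cons_zero, Fin.val_ofNat]
      exact Nat.mod_eq_of_lt (by omega)
    | succ i =>
      rw [code_ones_even_succ hM, if_neg (by omega), hr']
      omega
  · have h3 : ¬ Even (2 * k + 1) := by simp
    have h4 : (2 * k + 1) / 2 = k := by omega
    have hw : lamWord (2 * k + 1) 2 =
        [Fin.ofNat (2 * k + 1 + 1) (k + 1), Fin.ofNat (2 * k + 1 + 1) (k + 1)] := by
      simp [lamWord, lam, t1, t2, h3, h4]
    have hr : Fin.rev (Fin.ofNat (2 * k + 1 + 1) (k + 1)) = Fin.ofNat (2 * k + 1 + 1) k := by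
      apply Fin.ext
      rw [Fin.val_rev, Fin.val_ofNat, Fin.val_ofNat, Nat.mod_eq_of_lt (by omega),
        Nat.mod_eq_of_lt (by omega)]
      omega
    have hr' := val_ofNat_add_one (N := 2 * k + 1) (k := k) (by omega)
    simp only [alphaPrime, h3, if_false, pow_one, hw, evPeriodic,
      Word.reflection, List.map_cons, List.map_nil, Word.plus, List.length_cons, List.length_nil,
      zero_add, Nat.reduceAdd, hr]
    by_cases hi : i < 2
    · rw [if_pos hi]
      have hv : (Fin.ofNat (2 * k + 1 + 1) (k + 1) : ℕ) = k + 1 := Nat.mod_eq_of_lt (by omega)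
      obtain rfl | rfl : i = 0 ∨ i = 2 * 0 + 1 := by omega
      · rw [code_ones_odd_zero]
        exact hv
      · rw [code_ones_odd_odd]
        exact hv
    · rw [if_neg hi]
      rcases Nat.even_or_odd' i with ⟨j, rfl | rfl⟩
      · obtain ⟨j, rfl⟩ : ∃ l, j = l + 1 := ⟨j - 1, by omega⟩
        rw [show (2 * (j + 1) - 2) % 2 = 0 by omega, code_ones_odd_even]
        simp only [List.getD_cons_zero, Fin.val_ofNat]
        exact Nat.mod_eq_of_lt (by omega)
      · rw [show (2 * j + 1 - 2) % 2 = 1 by omega, code_ones_odd_odd]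
        simp only [List.getD_cons_zero, List.getD_cons_succ]
        exact hr'

theorem not_eventually_zero_of_le {x : Omega M} {f : ℕ → ℕ} (h : ∀ n, n ≤ f n)
    (hx : ∀ n, 1 ≤ (x (f n) : ℕ)) : ¬ ∃ N, ∀ i, N ≤ i → x i = 0 := by
  rintro ⟨N, hN⟩
  have h1 := hx N
  rw [hN _ (h N)] at h1
  simp at h1

theorem shift_code_ones_le (hM : 1 ≤ M) (n : ℕ) :
    toLex (shift n (code M 0 ones)) ≤ toLex (code M 0 ones) := by
  by_cases hn : (unitLift M).length ∣ n
  · obtain ⟨m, rfl⟩ := hn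
    rw [shift_code hM]
    cases m with
    | zero => exact le_rfl
    | succ m => exact (code_one_lt_code_zero hM _ rfl).le
  · exact (shift_code_lt hM 0 ones rfl hn).le

theorem alpha_qT (hM : 1 ≤ M) : 1 < qT M ∧ qT M ≤ M + 1 ∧ alpha M (qT M) = code M 0 ones := by
  rw [qT, qPrime, alphaPrime_one hM]
  refine baseOf_spec hM ?_ (shift_code_ones_le hM)
  rcases Nat.even_or_odd' M with ⟨k, rfl | rfl⟩
  · refine not_eventually_zero_of_le (f := fun n => n + 1) (fun n => by omega) fun n => ?_
    rw [code_ones_even_succ hM]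
    omega
  · refine not_eventually_zero_of_le (f := fun n => 2 * n + 1) (fun n => by omega) fun n => ?_
    rw [code_ones_odd_odd]
    omega

theorem shift_code_zeros_le (hM : 1 ≤ M) (n : ℕ) :
    toLex (shift n (code M 0 zeros)) ≤ toLex (code M 0 zeros) := by
  by_cases hn : (unitLift M).length ∣ n
  · obtain ⟨m, rfl⟩ := hn
    rw [shift_code hM]
    cases m <;> exact le_rfl
  · rcases Nat.even_or_odd' M with ⟨k, rfl | rfl⟩
    · simp [unitLift_length_even] at hn
    · rw [unitLift_length_odd] at hn
      obtain ⟨m, rfl⟩ : ∃ m, n = 2 * m + 1 := ⟨n / 2, by omega⟩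
      refine le_of_lt (lex_lt_iff.2 ⟨0, by simp, ?_⟩)
      have h1 := code_zeros_odd_odd (k := k) m
      have h2 := code_zeros_odd_even (k := k) 0
      rw [Fin.lt_def]
      simp only [shift, zero_add, mul_zero] at h2 ⊢
      omega

theorem alpha_qG (hM : 1 ≤ M) : 1 < qG M ∧ qG M ≤ M + 1 ∧ alpha M (qG M) = code M 0 zeros := by
  rw [qG, evPeriodic_unitLift hM]
  refine baseOf_spec hM ?_ (shift_code_zeros_le hM)
  rcases Nat.even_or_odd' M with ⟨k, rfl | rfl⟩
  · refine not_eventually_zero_of_le (f := fun n => n) (fun n => le_rfl) fun n => ?_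
    rw [code_zeros_even hM]
    omega
  · refine not_eventually_zero_of_le (f := fun n => 2 * n) (fun n => by omega) fun n => ?_
    rw [code_zeros_odd_even]
    omega

end Bounds

end Univoque

namespace Univoque

/-! ### Sequences bounded by `𝐮⁺ (reflection 𝐮)^∞` are codes -/

section Structure

variable {M : ℕ}

/-- Away from position 0 the sequence has period `|𝐮|`, so the offset from a block boundary can be
replaced by the absolute position. Strictness of `h` excludes offset 0. -/
theorem code_ones_sub (hM : 1 ≤ M) {m e : ℕ} (h : (unitLift M).length * m < e) :
    code M 0 ones (e - (unitLift M).length * m) = code M 0 ones e := by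
  apply Fin.ext
  rcases Nat.even_or_odd' M with ⟨k, rfl | rfl⟩
  · rw [unitLift_length_even, one_mul] at *
    obtain ⟨e, rfl⟩ : ∃ c, e = c + 1 := ⟨e - 1, by omega⟩
    rw [show e + 1 - m = e - m + 1 by omega, code_ones_even_succ hM, code_ones_even_succ hM]
  · rw [unitLift_length_odd] at *
    rcases Nat.even_or_odd' e with ⟨c, rfl | rfl⟩
    · obtain ⟨c, rfl⟩ : ∃ d, c = d + 1 := ⟨c - 1, by omega⟩
      rw [show 2 * (c + 1) - 2 * m = 2 * (c - m + 1) by omega, code_ones_odd_even,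
        code_ones_odd_even]
    · rw [show 2 * c + 1 - 2 * m = 2 * (c - m) + 1 by omega, code_ones_odd_odd, code_ones_odd_odd]

/-- From some block boundary on, up to position `e`, the digits are those of
`𝐮⁺ (reflection 𝐮)^∞`. -/
def FollowsOnes (x : Omega M) (e : ℕ) : Prop :=
  ∃ m, (unitLift M).length * m < e ∧
    ∀ j, (unitLift M).length * m ≤ j → j < e → x j = code M 0 ones (j - (unitLift M).length * m)

theorem FollowsOnes.digit_le (hM : 1 ≤ M) {x : Omega M} {e : ℕ}
    (hx : ∀ n, toLex (shift n x) ≤ toLex (code M 0 ones)) (h : FollowsOnes x e) :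
    x e ≤ code M 0 ones e := by
  obtain ⟨m, hm, hj⟩ := h
  have := digit_le_of_lex_le (hx ((unitLift M).length * m)) (n := e - (unitLift M).length * m)
    fun i hi => by
      have := hj (i + (unitLift M).length * m) (by omega) (by omega)
      rwa [Nat.add_sub_cancel] at this
  rw [code_ones_sub hM hm] at this
  simpa only [shift, Nat.sub_add_cancel hm.le] using this

theorem FollowsOnes.succ (hM : 1 ≤ M) {x : Omega M} {e : ℕ} (h : FollowsOnes x e)
    (he : x e = code M 0 ones e) : FollowsOnes x (e + 1) := by
  obtain ⟨m, hm, hj⟩ := h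
  refine ⟨m, by omega, fun j h1 h2 => ?_⟩
  rcases Nat.lt_succ_iff_lt_or_eq.1 h2 with h2 | rfl
  · exact hj j h1 h2
  · rw [he, code_ones_sub hM hm]

theorem followsOnes_even {k : ℕ} (hk : 1 ≤ 2 * k) {x : Omega (2 * k)} {i : ℕ}
    (h : (x i : ℕ) = k + 1) : FollowsOnes x (i + 1) := by
  refine ⟨i, by rw [unitLift_length_even]; omega, fun j h1 h2 => ?_⟩
  rw [unitLift_length_even, one_mul] at *
  obtain rfl : j = i := by omega
  apply Fin.ext
  rw [h, Nat.sub_self, code_ones_even_zero hk]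

theorem followsOnes_odd {k : ℕ} {x : Omega (2 * k + 1)} {i : ℕ}
    (h : (x (2 * i) : ℕ) = k + 1) (h' : (x (2 * i + 1) : ℕ) = k + 1) :
    FollowsOnes x (2 * i + 2) := by
  refine ⟨i, by rw [unitLift_length_odd]; omega, fun j h1 h2 => ?_⟩
  rw [unitLift_length_odd] at *
  apply Fin.ext
  obtain rfl | rfl : j = 2 * i ∨ j = 2 * i + 1 := by omega
  · rw [h, Nat.sub_self, code_ones_odd_zero]
  · rw [h', show 2 * i + 1 - 2 * i = 2 * 0 + 1 by omega, code_ones_odd_odd]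

/-- The sequences all of whose tails, and those of their reflections, are at most
`𝐮⁺ (reflection 𝐮)^∞`. -/
def BoundedByOnes (x : Omega M) : Prop :=
  ∀ n, toLex (shift n x) ≤ toLex (code M 0 ones) ∧
    toLex (shift n (reflection x)) ≤ toLex (code M 0 ones)

theorem BoundedByOnes.reflection {x : Omega M} (h : BoundedByOnes x) :
    BoundedByOnes (reflection x) := fun n =>
  ⟨(h n).2, by rw [reflection_reflection]; exact (h n).1⟩

theorem BoundedByOnes.digit_le {x : Omega M} (h : BoundedByOnes x) (n : ℕ) :
    x n ≤ code M 0 ones 0 := by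
  have := digit_le_of_lex_le (h n).1 (n := 0) (by simp)
  simpa [shift] using this

theorem BoundedByOnes.digit_bounds_even {k : ℕ} (hk : 1 ≤ 2 * k) {x : Omega (2 * k)}
    (h : BoundedByOnes x) (n : ℕ) : (x n : ℕ) ≤ k + 1 ∧ k ≤ (x n : ℕ) + 1 := by
  have h1 := Fin.le_def.1 (h.digit_le n)
  have h2 := Fin.le_def.1 (h.reflection.digit_le n)
  have h3 := reflection_val x n
  rw [code_ones_even_zero hk] at h1 h2
  omega

theorem BoundedByOnes.digit_bounds_odd {k : ℕ} {x : Omega (2 * k + 1)}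
    (h : BoundedByOnes x) (n : ℕ) : (x n : ℕ) ≤ k + 1 ∧ k ≤ (x n : ℕ) := by
  have h1 := Fin.le_def.1 (h.digit_le n)
  have h2 := Fin.le_def.1 (h.reflection.digit_le n)
  have h3 := reflection_val x n
  rw [code_ones_odd_zero] at h1 h2
  omega

/-- The bound caps the next digit at `k`. Digit `k` continues the pattern; the only alternative, `k
- 1`, reflects to `k + 1` and starts the pattern in the reflection. -/
theorem followsOnes_step_even {k : ℕ} (hk : 1 ≤ 2 * k) {x : Omega (2 * k)}
    (h : BoundedByOnes x) {i : ℕ} (hf : FollowsOnes x (i + 1)) :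
    ((x (i + 1) : ℕ) = k ∧ FollowsOnes x (i + 2)) ∨
      ((x (i + 1) : ℕ) + 1 = k ∧ FollowsOnes (reflection x) (i + 2)) := by
  have h1 := Fin.le_def.1 (hf.digit_le hk fun n => (h n).1)
  have h2 := h.digit_bounds_even hk (i + 1)
  have h3 := reflection_val x (i + 1)
  rw [code_ones_even_succ hk] at h1
  by_cases hx : (x (i + 1) : ℕ) = k
  · exact Or.inl ⟨hx, hf.succ hk (Fin.ext (by rw [code_ones_even_succ hk, hx]))⟩
  · exact Or.inr ⟨by omega, followsOnes_even hk (by omega)⟩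

/-- The first digit of the next block is forced to be `k`. A second digit `k + 1` continues the
pattern, while `k` completes the reflection of `𝐮⁺`. -/
theorem followsOnes_step_odd {k : ℕ} {x : Omega (2 * k + 1)}
    (h : BoundedByOnes x) {i : ℕ} (hf : FollowsOnes x (2 * i + 2)) :
    (x (2 * (i + 1)) : ℕ) = k ∧
      (((x (2 * (i + 1) + 1) : ℕ) = k + 1 ∧ FollowsOnes x (2 * (i + 1) + 2)) ∨
      ((x (2 * (i + 1) + 1) : ℕ) = k ∧ FollowsOnes (reflection x) (2 * (i + 1) + 2))) := by
  have hM : 1 ≤ 2 * k + 1 := by omega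
  have hf' : FollowsOnes x (2 * (i + 1)) := hf
  have h1 := Fin.le_def.1 (hf'.digit_le hM fun n => (h n).1)
  have h2 := h.digit_bounds_odd (2 * (i + 1))
  have h3 := h.digit_bounds_odd (2 * (i + 1) + 1)
  have h4 := reflection_val x (2 * (i + 1))
  have h5 := reflection_val x (2 * (i + 1) + 1)
  rw [code_ones_odd_even] at h1
  have h6 : (x (2 * (i + 1)) : ℕ) = k := by omega
  have h7 := hf'.succ hM (Fin.ext (by rw [code_ones_odd_even, h6]))
  refine ⟨h6, ?_⟩
  by_cases hx : (x (2 * (i + 1) + 1) : ℕ) = k + 1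
  · exact Or.inl ⟨hx, h7.succ hM (Fin.ext (by rw [code_ones_odd_odd, hx]))⟩
  · exact Or.inr ⟨by omega, followsOnes_odd (by omega) (by omega)⟩

theorem exists_state_sequence {R : ℕ → Fin 2 → Prop} {Q : ℕ → Fin 2 → Fin 2 → Prop} (h0 : R 0 1)
    (h : ∀ i s, R i s → ∃ t, R (i + 1) t ∧ Q i s t) :
    ∃ y : ℕ → Fin 2, y 0 = 1 ∧ ∀ i, Q i (y i) (y (i + 1)) := by
  choose f hf using h
  let z : ∀ i, {s // R i s} := fun i =>
    Nat.rec ⟨1, h0⟩ (fun i s => ⟨f i s.1 s.2, (hf i s.1 s.2).1⟩) i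
  exact ⟨fun i => (z i).1, rfl, fun i => (hf i (z i).1 (z i).2).2⟩

/-- The sequences between the reflection of `𝐮⁺ (reflection 𝐮)^∞` and this sequence that begin
with `𝐮⁺` are codes. -/
theorem BoundedByOnes.exists_code (hM : 1 ≤ M) {x : Omega M} (h : BoundedByOnes x)
    (hx : initialWord (unitLift M).length x = (unitLift M).plus) :
    ∃ y : Omega 1, y 0 = 1 ∧ x = code M 0 y := by
  rcases Nat.even_or_odd' M with ⟨k, rfl | rfl⟩
  · rw [initialWord_eq_plus_even hM] at hx
    obtain ⟨y, hy0, hy⟩ := exists_state_sequence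
      -- Invariant of the walk: in state 1 the sequence follows the bound, in state 0 its reflection
      -- does. The relation `Q` is the digit equation of the code.
      (R := fun i s => (s = 1 ∧ FollowsOnes x (i + 1)) ∨
        (s = 0 ∧ FollowsOnes (Univoque.reflection x) (i + 1)))
      (Q := fun i s t => (x (i + 1) : ℕ) + s = k + t)
      (Or.inl ⟨rfl, followsOnes_even hM hx⟩) (by
        rintro i s (⟨rfl, hs⟩ | ⟨rfl, hs⟩)
        · rcases followsOnes_step_even hM h hs with ⟨h1, h2⟩ | ⟨h1, h2⟩
          · exact ⟨1, Or.inl ⟨rfl, h2⟩, by simp [h1]⟩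
          · exact ⟨0, Or.inr ⟨rfl, h2⟩, by simp [h1]⟩
        · have h0 := reflection_val x (i + 1)
          rcases followsOnes_step_even hM h.reflection hs with ⟨h1, h2⟩ | ⟨h1, h2⟩
          · refine ⟨0, Or.inr ⟨rfl, h2⟩, ?_⟩
            simp only [Fin.isValue, Fin.val_zero]
            omega
          · rw [reflection_reflection] at h2
            refine ⟨1, Or.inl ⟨rfl, h2⟩, ?_⟩
            simp only [Fin.isValue, Fin.val_zero, Fin.val_one]
            omega)
    refine ⟨y, hy0, funext fun i => Fin.ext ?_⟩
    have h1 := code_even hM 0 y i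
    cases i with
    | zero =>
      simp only [prevDigit, Fin.isValue, Fin.val_zero, hy0, Fin.val_one] at h1
      omega
    | succ i =>
      have h2 := hy i
      simp only [prevDigit] at h1
      omega
  · rw [initialWord_eq_plus_odd] at hx
    obtain ⟨y, hy0, hy⟩ := exists_state_sequence
      (R := fun i s => (s = 1 ∧ FollowsOnes x (2 * i + 2)) ∨
        (s = 0 ∧ FollowsOnes (Univoque.reflection x) (2 * i + 2)))
      (Q := fun i s t => (x (2 * (i + 1)) : ℕ) + s = k + 1 ∧ (x (2 * (i + 1) + 1) : ℕ) = k + t)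
      (Or.inl ⟨rfl, followsOnes_odd (i := 0) hx.1 hx.2⟩) (by
        rintro i s (⟨rfl, hs⟩ | ⟨rfl, hs⟩)
        · obtain ⟨h0, ⟨h1, h2⟩ | ⟨h1, h2⟩⟩ := followsOnes_step_odd h hs
          · exact ⟨1, Or.inl ⟨rfl, h2⟩, by simp [h0, h1]⟩
          · exact ⟨0, Or.inr ⟨rfl, h2⟩, by simp [h0, h1]⟩
        · have h3 := reflection_val x (2 * (i + 1))
          have h4 := reflection_val x (2 * (i + 1) + 1)
          obtain ⟨h0, ⟨h1, h2⟩ | ⟨h1, h2⟩⟩ := followsOnes_step_odd h.reflection hs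
          · refine ⟨0, Or.inr ⟨rfl, h2⟩, ?_⟩
            simp only [Fin.isValue, Fin.val_zero]
            omega
          · rw [reflection_reflection] at h2
            refine ⟨1, Or.inl ⟨rfl, h2⟩, ?_⟩
            simp only [Fin.isValue, Fin.val_zero, Fin.val_one]
            omega)
    refine ⟨y, hy0, funext fun i => Fin.ext ?_⟩
    rcases Nat.even_or_odd' i with ⟨j, rfl | rfl⟩
    · have h1 := code_odd_fst (k := k) 0 y j
      cases j with
      | zero =>
        have := hx.1
        simp only [prevDigit, Fin.isValue, Fin.val_zero, mul_zero] at h1 ⊢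
        omega
      | succ j =>
        have h2 := hy j
        simp only [prevDigit] at h1
        omega
    · have h1 := code_odd_snd (k := k) 0 y j
      cases j with
      | zero =>
        have := hx.2
        simp only [Fin.isValue, hy0, Fin.val_one, mul_zero, zero_add] at h1 ⊢
        omega
      | succ j =>
        have h2 := hy j
        omega

/-- All digits are at most `a 0 ≤ k + 1`. For odd `M`, the first excess over `𝐮^∞` is therefore a `k
+ 1` ending a block `(k+1)(k+1)`; were it not the first block, `a` would begin with `(k+1)k` and be
exceeded by its own tail. -/
theorem initialWord_eq_plus_of_code_zeros_lt (hM : 1 ≤ M) {a : Omega M}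
    (h : ∀ n, toLex (shift n a) ≤ toLex a) (hlt : toLex (code M 0 zeros) < toLex a)
    (hle : toLex a ≤ toLex (code M 0 ones)) :
    initialWord (unitLift M).length a = (unitLift M).plus := by
  obtain ⟨n, h1, h2⟩ := lex_lt_iff.1 hlt
  have hle0 := Fin.le_def.1 (digit_le_of_lex_le hle (n := 0) (by simp))
  have hdig : ∀ n, (a n : ℕ) ≤ a 0 := fun n => by
    have := digit_le_of_lex_le (h n) (n := 0) (by simp)
    simpa [shift] using this
  rw [Fin.lt_def] at h2
  have hn := hdig n
  rcases Nat.even_or_odd' M with ⟨k, rfl | rfl⟩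
  · rw [initialWord_eq_plus_even hM]
    rw [code_ones_even_zero hM] at hle0
    rw [code_zeros_even hM] at h2
    omega
  · rw [initialWord_eq_plus_odd]
    rw [code_ones_odd_zero] at hle0
    rcases Nat.even_or_odd' n with ⟨j, rfl | rfl⟩
    · rw [code_zeros_odd_even] at h2
      omega
    · rw [code_zeros_odd_odd] at h2
      have h3 := h1 (2 * j) (by omega)
      have h4 := code_zeros_odd_even (k := k) j
      have h5 := h1 0 (by omega)
      have h6 := code_zeros_odd_even (k := k) 0
      rw [h3] at h4
      rw [mul_zero, h5] at h6
      refine ⟨h6, ?_⟩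
      cases j with
      | zero =>
        simp only [mul_zero, zero_add] at h2 hn
        omega
      | succ j =>
        exfalso
        have h7 := h1 1 (by omega)
        have h8 := code_zeros_odd_odd (k := k) 0
        rw [mul_zero, zero_add, h7] at h8
        have h9 := digit_le_of_lex_le (h (2 * (j + 1))) (n := 1) (by
          intro i hi
          obtain rfl : i = 0 := by omega
          apply Fin.ext
          simp only [shift, zero_add]
          omega)
        rw [Fin.le_def] at h9
        simp only [shift, add_comm 1] at h9
        omega

/-- A sequence between the reflection of `𝐮⁺ (reflection 𝐮)^∞` and this sequence is, up to
reflection, a tail of `𝐮^∞` followed by a sequence that begins with `𝐮⁺`. -/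
theorem BoundedByOnes.exists_prefix (hM : 1 ≤ M) {x : Omega M} (h : BoundedByOnes x) :
    ∃ s : Fin 2, (∀ i, x i = code M s (fun _ => s) i) ∨
      ∃ j, (∀ i < j, x i = code M s (fun _ => s) i) ∧
        (initialWord (unitLift M).length (shift j x) = (unitLift M).plus ∨
          initialWord (unitLift M).length (Univoque.reflection (shift j x)) =
            (unitLift M).plus) := by
  classical
  rcases Nat.even_or_odd' M with ⟨k, rfl | rfl⟩
  · refine ⟨0, ?_⟩
    by_cases hc : ∀ i, x i = code (2 * k) 0 zeros i
    · exact Or.inl hc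
    right
    push Not at hc
    obtain ⟨j, hj, hmin⟩ : ∃ j, x j ≠ code (2 * k) 0 zeros j ∧
        ∀ i < j, x i = code (2 * k) 0 zeros i :=
      ⟨Nat.find hc, Nat.find_spec hc, fun i hi => not_not.1 (Nat.find_min hc hi)⟩
    refine ⟨j, hmin, ?_⟩
    rw [initialWord_eq_plus_even hM, initialWord_eq_plus_even hM]
    have h1 := h.digit_bounds_even hM j
    have h2 := reflection_val x j
    have h3 : (x j : ℕ) ≠ k := fun h' => hj (Fin.ext (by rw [h', code_zeros_even hM]))
    simp only [reflection_shift, shift, zero_add]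
    omega
  · have hd := h.digit_bounds_odd
    have hr := reflection_val x
    -- The state `s` selects the phase of the alternating word: `(k+1)k…` for 0 and `k(k+1)…` for 1.
    obtain ⟨s, hs⟩ : ∃ s : Fin 2, (x 0 : ℕ) + s = k + 1 :=
      ⟨⟨k + 1 - x 0, by have := hd 0; omega⟩, by have := hd 0; simp only; omega⟩
    have hfst := code_odd_fst (k := k) s (fun _ => s)
    have hsnd := code_odd_snd (k := k) s (fun _ => s)
    have hprev : ∀ i, prevDigit s (fun _ => s) i = s := fun i => by cases i <;> rfl
    simp only [hprev] at hfst
    have halt : ∀ i, (code (2 * k + 1) s (fun _ => s) i : ℕ) +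
        code (2 * k + 1) s (fun _ => s) (i + 1) = 2 * k + 1 := by
      intro i
      rcases Nat.even_or_odd' i with ⟨j, rfl | rfl⟩
      · have h1 := hfst j
        have h2 := hsnd j
        omega
      · have h1 := hsnd j
        have h2 := hfst (j + 1)
        rw [show 2 * j + 1 + 1 = 2 * (j + 1) by ring]
        omega
    have hagree : ∀ j, (∀ i < j, (x i : ℕ) + x (i + 1) = 2 * k + 1) →
        x j = code (2 * k + 1) s (fun _ => s) j := by
      intro j
      induction j with
      | zero =>
        intro _
        apply Fin.ext
        have := hfst 0
        rw [mul_zero] at this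
        omega
      | succ j ih =>
        intro hj
        have h1 := ih fun i hi => hj i (by omega)
        have h2 := hj j (by omega)
        have h3 := halt j
        apply Fin.ext
        rw [h1] at h2
        omega
    refine ⟨s, ?_⟩
    -- Alternation fails first at two equal neighbours, `(k+1)(k+1)` or `kk`, that is, at `𝐮⁺` or
    -- its reflection.
    by_cases hc : ∀ i, (x i : ℕ) + x (i + 1) = 2 * k + 1
    · exact Or.inl fun i => hagree i fun j _ => hc j
    right
    push Not at hc
    obtain ⟨j, hj, hmin⟩ : ∃ j, (x j : ℕ) + x (j + 1) ≠ 2 * k + 1 ∧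
        ∀ i < j, (x i : ℕ) + x (i + 1) = 2 * k + 1 :=
      ⟨Nat.find hc, Nat.find_spec hc, fun i hi => not_not.1 (Nat.find_min hc hi)⟩
    refine ⟨j, fun i hi => hagree i fun l hl => hmin l (hl.trans hi), ?_⟩
    rw [initialWord_eq_plus_odd, initialWord_eq_plus_odd]
    have h1 := hd j
    have h2 := hd (j + 1)
    have h3 := hr j
    have h4 := hr (j + 1)
    simp only [reflection_shift, shift, zero_add, add_comm 1 j]
    omega

end Structure

end Univoque

namespace Univoque

/-! ### Entropy -/

section Entropy

variable {M : ℕ}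

theorem initialWord_eq_iff {n : ℕ} {x y : Omega M} :
    initialWord n x = initialWord n y ↔ ∀ i < n, x i = y i := by
  simp only [initialWord]
  rw [List.ofFn_inj, funext_iff]
  exact ⟨fun h i hi => h ⟨i, hi⟩, fun h i => h i i.2⟩

theorem initialWord_getD {n : ℕ} (x : Omega M) {i : ℕ} (hi : i < n) :
    (initialWord n x).getD i 0 = x i := by
  simp [initialWord, hi]

theorem initialWords_finite (n : ℕ) (X : Set (Omega M)) : (initialWords n X).Finite := by
  refine (List.finite_length_eq (Fin (M + 1)) n).subset ?_
  rintro _ ⟨x, -, rfl⟩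
  simp [initialWord]

theorem ncard_initialWords_mono {X Y : Set (Omega M)} (h : X ⊆ Y) (n : ℕ) :
    (initialWords n X).ncard ≤ (initialWords n Y).ncard :=
  Set.ncard_le_ncard (Set.image_mono h) (initialWords_finite n Y)

theorem ncard_initialWords_pos {X : Set (Omega M)} (h : X.Nonempty) (n : ℕ) :
    0 < (initialWords n X).ncard :=
  (Set.ncard_pos (initialWords_finite n X)).2 (h.image _)

/-- Serves to count initial words of codes by initial words of the coded sequences. -/
theorem ncard_image_eq_of_kernel_eq {α β γ : Type*} {f : α → β} {g : α → γ} (S : Set α)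
    (h : ∀ a ∈ S, ∀ b ∈ S, f a = f b ↔ g a = g b) : (f '' S).ncard = (g '' S).ncard := by
  refine Set.ncard_congr (fun b hb => g hb.choose) ?_ ?_ ?_
  · exact fun b hb => ⟨_, hb.choose_spec.1, rfl⟩
  · intro b c hb hc hbc
    have := (h _ hb.choose_spec.1 _ hc.choose_spec.1).2 hbc
    rwa [hb.choose_spec.2, hc.choose_spec.2] at this
  · rintro _ ⟨a, ha, rfl⟩
    have hb : f a ∈ f '' S := ⟨a, ha, rfl⟩
    exact ⟨f a, hb, (h _ hb.choose_spec.1 _ ha).1 hb.choose_spec.2⟩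

/-- If each sequence of `X` follows one of finitely many sequences up to some position, and an
element of `Y` from there on, then `X` has at most linearly many times as many words as `Y`. -/
theorem ncard_initialWords_le_of_prefix {ι : Type*} [Fintype ι] (P : ι → Omega M)
    {X Y : Set (Omega M)} (hY : Y.Nonempty)
    (h : ∀ x ∈ X, ∃ a, (∀ i, x i = P a i) ∨ ∃ j, (∀ i < j, x i = P a i) ∧ shift j x ∈ Y) (n : ℕ) :
    (initialWords n X).ncard ≤ Fintype.card ι * (n + 1) * (initialWords n Y).ncard := by
  -- A word is recovered from the followed sequence, the cutting position (capped at `n`), and a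
  -- word of `Y` of full length `n`, of which only a beginning is used.
  let f : (ι × Fin (n + 1)) × Word M → Word M := fun t =>
    List.ofFn fun i : Fin n => if (i : ℕ) < t.1.2 then P t.1.1 i else t.2.getD (i - t.1.2) 0
  have hsub : initialWords n X ⊆ f '' (Set.univ ×ˢ initialWords n Y) := by
    rintro _ ⟨x, hx, rfl⟩
    obtain ⟨a, ha | ⟨j, hj, hxj⟩⟩ := h x hx
    · obtain ⟨y, hy⟩ := hY
      refine ⟨((a, Fin.last n), initialWord n y), ⟨trivial, y, hy, rfl⟩, ?_⟩
      simp only [f, initialWord, List.ofFn_inj, Fin.val_last]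
      funext i
      simp [ha]
    · refine ⟨((a, ⟨min j n, by omega⟩), initialWord n (shift j x)), ⟨trivial, _, hxj, rfl⟩, ?_⟩
      refine congrArg List.ofFn (funext fun i => ?_)
      have hi := i.2
      dsimp only
      by_cases hij : (i : ℕ) < j
      · simp [hij, hj _ hij]
      · have hn : ¬ (i : ℕ) < min j n := by omega
        rw [if_neg hn, initialWord_getD _ (by omega), min_eq_left (by omega)]
        simp only [shift]
        rw [Nat.sub_add_cancel (by omega)]
  refine (Set.ncard_le_ncard hsub
    ((Set.finite_univ.prod (initialWords_finite n Y)).image _)).trans ?_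
  refine (Set.ncard_image_le (Set.finite_univ.prod (initialWords_finite n Y))).trans ?_
  rw [Set.ncard_prod, Set.ncard_univ, Nat.card_eq_fintype_card, Fintype.card_prod, Fintype.card_fin]

/-- Accounts for the digit that breaks the initial constant run of a univoque sequence. -/
theorem ncard_initialWords_le_of_shift_one {X Y : Set (Omega M)} (h : ∀ x ∈ X, shift 1 x ∈ Y)
    (n : ℕ) : (initialWords n X).ncard ≤ (M + 1) * (initialWords n Y).ncard := by
  let f : Fin (M + 1) × Word M → Word M := fun t =>
    List.ofFn fun i : Fin n => if (i : ℕ) = 0 then t.1 else t.2.getD (i - 1) 0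
  have hsub : initialWords n X ⊆ f '' (Set.univ ×ˢ initialWords n Y) := by
    rintro _ ⟨x, hx, rfl⟩
    refine ⟨(x 0, initialWord n (shift 1 x)), ⟨trivial, _, h x hx, rfl⟩, ?_⟩
    refine congrArg List.ofFn (funext fun i => ?_)
    have hi := i.2
    dsimp only
    by_cases h0 : (i : ℕ) = 0
    · rw [if_pos h0, h0]
    · rw [if_neg h0, initialWord_getD _ (by omega)]
      simp only [shift]
      rw [Nat.sub_add_cancel (by omega)]
  refine (Set.ncard_le_ncard hsub
    ((Set.finite_univ.prod (initialWords_finite n Y)).image _)).trans ?_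
  refine (Set.ncard_image_le (Set.finite_univ.prod (initialWords_finite n Y))).trans ?_
  rw [Set.ncard_prod, Set.ncard_univ, Nat.card_eq_fintype_card, Fintype.card_fin]

theorem ncard_initialWords_union_reflection (Y : Set (Omega M)) (n : ℕ) :
    (initialWords n {x | x ∈ Y ∨ reflection x ∈ Y}).ncard ≤ 2 * (initialWords n Y).ncard := by
  have hsub : initialWords n {x | x ∈ Y ∨ reflection x ∈ Y} ⊆
      initialWords n Y ∪ (List.map Fin.rev) '' initialWords n Y := by
    rintro _ ⟨x, hx | hx, rfl⟩
    · exact Or.inl ⟨x, hx, rfl⟩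
    · refine Or.inr ⟨_, ⟨_, hx, rfl⟩, ?_⟩
      simp only [initialWord, List.map_ofFn]
      congr 1
      funext i
      simp [reflection]
  have hfin := initialWords_finite n Y
  refine (Set.ncard_le_ncard hsub (hfin.union (hfin.image _))).trans ?_
  refine (Set.ncard_union_le _ _).trans ?_
  have := Set.ncard_image_le (f := List.map Fin.rev) hfin
  omega

/-- A shift-invariant set has a topological entropy, by Fekete's lemma. -/
theorem exists_hasEntropy_of_shift {X : Set (Omega M)} (hne : X.Nonempty)
    (h : ∀ x ∈ X, ∀ n, shift n x ∈ X) : ∃ e, HasEntropy X e := by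
  have hsub : Subadditive fun n : ℕ => Real.log ((initialWords n X).ncard : ℝ) := by
    intro m n
    have hm := ncard_initialWords_pos hne m
    have hn := ncard_initialWords_pos hne n
    have hmn := ncard_initialWords_pos hne (m + n)
    have hle : (initialWords (m + n) X).ncard ≤
        (initialWords m X).ncard * (initialWords n X).ncard := by
      rw [← Set.ncard_prod]
      have hfin := (initialWords_finite m X).prod (initialWords_finite n X)
      refine (Set.ncard_le_ncard ?_ (hfin.image fun t => t.1 ++ t.2)).trans
        (Set.ncard_image_le hfin)
      rintro _ ⟨x, hx, rfl⟩
      refine ⟨(initialWord m x, initialWord n (shift m x)), ⟨⟨x, hx, rfl⟩, _, h x hx m, rfl⟩, ?_⟩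
      simp only [initialWord]
      rw [List.ofFn_add]
      congr 2
      funext i
      simp [shift, add_comm]
    have hm0 : ((initialWords m X).ncard : ℝ) ≠ 0 := by positivity
    have hn0 : ((initialWords n X).ncard : ℝ) ≠ 0 := by positivity
    rw [← Real.log_mul hm0 hn0]
    refine Real.log_le_log (by positivity) ?_
    exact_mod_cast hle
  refine ⟨hsub.lim, hsub.tendsto_lim ⟨0, ?_⟩⟩
  rintro _ ⟨n, rfl⟩
  have := Real.log_natCast_nonneg (initialWords n X).ncard
  dsimp only
  positivity

theorem tendsto_log_mul_succ_div (C : ℕ) (hC : 0 < C) :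
    Tendsto (fun n : ℕ => Real.log ((C : ℝ) * (n + 1)) / n) atTop (𝓝 0) := by
  have hC' : (0 : ℝ) < C := by exact_mod_cast hC
  have h1 : Tendsto (fun n : ℕ => (C : ℝ) * (n + 1)) atTop atTop :=
    (tendsto_atTop_add_const_right _ 1 tendsto_natCast_atTop_atTop).const_mul_atTop hC'
  have h2 : Tendsto (fun n : ℕ => Real.log ((C : ℝ) * (n + 1)) / (C * (n + 1))) atTop (𝓝 0) :=
    (Real.isLittleO_log_id_atTop.tendsto_div_nhds_zero).comp h1
  have h3 : Tendsto (fun n : ℕ => (C : ℝ) + C / n) atTop (𝓝 (C + 0)) :=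
    (tendsto_const_div_atTop_nhds_zero_nat (C : ℝ)).const_add _
  have h4 := h2.mul h3
  rw [zero_mul] at h4
  refine h4.congr' ?_
  filter_upwards [eventually_gt_atTop 0] with n hn
  have : (0 : ℝ) < n := by exact_mod_cast hn
  field_simp

/-- Sets whose numbers of words differ by at most a linear factor have the same entropy. -/
theorem HasEntropy.of_comparable {X Y : Set (Omega M)} {e : ℝ} (hX : X.Nonempty)
    (hY : Y.Nonempty) {C : ℕ}
    (h1 : ∀ n, (initialWords n X).ncard ≤ C * (n + 1) * (initialWords n Y).ncard)
    (h2 : ∀ n, (initialWords n Y).ncard ≤ C * (n + 1) * (initialWords n X).ncard)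
    (h : HasEntropy X e) : HasEntropy Y e := by
  have hC : 0 < C := by
    by_contra hC
    have := h1 0
    have := ncard_initialWords_pos hX 0
    simp_all
  have key : ∀ (X Y : Set (Omega M)), X.Nonempty → Y.Nonempty →
      (∀ n, (initialWords n X).ncard ≤ C * (n + 1) * (initialWords n Y).ncard) → ∀ n : ℕ,
      Real.log ((initialWords n X).ncard : ℝ) / n ≤
        Real.log ((C : ℝ) * (n + 1)) / n + Real.log ((initialWords n Y).ncard : ℝ) / n := by
    intro X Y hX hY hXY n
    have hx : (0 : ℝ) < (initialWords n X).ncard := by exact_mod_cast ncard_initialWords_pos hX n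
    have hy : (0 : ℝ) < (initialWords n Y).ncard := by exact_mod_cast ncard_initialWords_pos hY n
    have hc : (0 : ℝ) < C := by exact_mod_cast hC
    rw [← add_div, ← Real.log_mul (by positivity) hy.ne']
    have : ((initialWords n X).ncard : ℝ) ≤ C * (n + 1) * (initialWords n Y).ncard := by
      exact_mod_cast hXY n
    gcongr
  have hlog := tendsto_log_mul_succ_div C hC
  have hlow := h.sub hlog
  have hup := hlog.add h
  rw [sub_zero] at hlow
  rw [zero_add] at hup
  refine tendsto_of_tendsto_of_tendsto_of_le_of_le hlow hup (fun n => ?_) (fun n => ?_)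
  · have := key X Y hX hY h1 n
    dsimp only
    linarith
  · exact key Y X hY hX h2 n

theorem hasEntropy_zero_of_bounded {X : Set (Omega M)} {C : ℕ}
    (h : ∀ n, (initialWords n X).ncard ≤ C) : HasEntropy X 0 := by
  refine tendsto_of_tendsto_of_tendsto_of_le_of_le tendsto_const_nhds
    (tendsto_const_div_atTop_nhds_zero_nat (Real.log (C + 1))) (fun n => ?_) (fun n => ?_)
  · have := Real.log_natCast_nonneg (initialWords n X).ncard
    dsimp only
    positivity
  · dsimp only
    rcases Nat.eq_zero_or_pos (initialWords n X).ncard with h0 | h0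
    · rw [h0]
      simp only [Nat.cast_zero, Real.log_zero, zero_div]
      have : 0 ≤ Real.log ((C : ℝ) + 1) := Real.log_nonneg (by simp)
      positivity
    · have h0' : (0 : ℝ) < (initialWords n X).ncard := by exact_mod_cast h0
      have h1 : ((initialWords n X).ncard : ℝ) ≤ C := by exact_mod_cast h n
      gcongr
      linarith

theorem hasEntropy_zero_of_finite {X : Set (Omega M)} (h : X.Finite) : HasEntropy X 0 :=
  hasEntropy_zero_of_bounded fun n => Set.ncard_image_le (f := initialWord n) h

/-- If `X` has as many words of length `L n` as `Y` has of length `n`, then the entropy of `Y` is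
`L` times that of `X`. -/
theorem HasEntropy.eq_mul_of_ncard_eq {N L : ℕ} (hL : 0 < L) {X : Set (Omega M)}
    {Y : Set (Omega N)} {e e' : ℝ} (hX : HasEntropy X e) (hY : HasEntropy Y e')
    (h : ∀ n, (initialWords (L * n) X).ncard = (initialWords n Y).ncard) : e' = L * e := by
  have hLn : Tendsto (fun n : ℕ => L * n) atTop atTop :=
    tendsto_id.const_mul_atTop' hL
  have h1 : Tendsto (fun n : ℕ => (L : ℝ) *
      (Real.log ((initialWords (L * n) X).ncard : ℝ) / (L * n : ℕ))) atTop (𝓝 (L * e)) :=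
    (hX.comp hLn).const_mul _
  refine tendsto_nhds_unique hY (h1.congr fun n => ?_)
  rw [h]
  have : (L : ℝ) ≠ 0 := by positivity
  push_cast
  field_simp

theorem hasEntropy_univoqueSeqs {q e : ℝ} (hM : 1 ≤ M) (hq : 1 < q) (hqM : q ≤ M + 1)
    (hne : (tildeU M q).Nonempty) (h : HasEntropy (tildeU M q) e) :
    HasEntropy (univoqueSeqs M q) e := by
  have hsub := tildeU_subset_univoqueSeqs (M := M) hq hqM
  -- One factor `M + 1` counts the digit of the constant run, the other the digit that breaks it.
  refine h.of_comparable hne (hne.mono hsub) (C := (M + 1) * (M + 1)) (fun n => ?_) (fun n => ?_)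
  · refine (ncard_initialWords_mono hsub n).trans (Nat.le_mul_of_pos_left _ (by positivity))
  · have hne' : {x : Omega M | shift 1 x ∈ tildeU M q}.Nonempty := by
      obtain ⟨x, hx⟩ := hne
      exact ⟨x, shift_mem_tildeU hx 1⟩
    have h1 := ncard_initialWords_le_of_prefix (ι := Fin (M + 1)) (fun d _ => d)
      (X := univoqueSeqs M q) hne' (fun x hx => ?_) n
    · have h2 := ncard_initialWords_le_of_shift_one (X := {x : Omega M | shift 1 x ∈ tildeU M q})
        (Y := tildeU M q) (fun x hx => hx) n
      rw [Fintype.card_fin] at h1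
      calc _ ≤ _ := h1
        _ ≤ (M + 1) * (n + 1) * ((M + 1) * (initialWords n (tildeU M q)).ncard) := by gcongr
        _ = _ := by ring
    · obtain ⟨d, hd | ⟨j, hj, hj'⟩⟩ := exists_shift_mem_tildeU hM hq hqM hx
      · exact ⟨d, Or.inl hd⟩
      · rw [add_comm, ← shift_shift] at hj'
        exact ⟨d, Or.inr ⟨j, hj, hj'⟩⟩

theorem hasEntropy_univoqueSeqs_of_isEmpty {q : ℝ} (hM : 1 ≤ M) (hq : 1 < q) (hqM : q ≤ M + 1)
    (hne : tildeU M q = ∅) : HasEntropy (univoqueSeqs M q) 0 := by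
  refine hasEntropy_zero_of_finite ((Set.finite_range fun (d : Fin (M + 1)) (_ : ℕ) => d).subset ?_)
  intro x hx
  obtain ⟨d, hd | ⟨j, hj, hj'⟩⟩ := exists_shift_mem_tildeU hM hq hqM hx
  · exact ⟨d, funext fun i => (hd i).symm⟩
  · simp [hne] at hj'

end Entropy

end Univoque

namespace Univoque

/-! ### Transfer of the lexicographic conditions and of the entropy -/

section Main

variable {M : ℕ} {q p : ℝ} {b : Omega 1}

theorem prevDigit_zero_or_one (s : Fin 2) : s = 0 ∨ s = 1 := by
  fin_cases s <;> simp

/-- After a digit 0 the code restarts in state 0 and can be compared with that of `b`. After a digit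
1 the bound passes on from the previous tail, since dropping a leading 1 does not increase it. -/
theorem shift_le_of_shift_code_le (hM : 1 ≤ M) {y : Omega 1}
    (h : ∀ n, toLex (shift n (code M 0 y)) ≤ toLex (code M 0 b)) (n : ℕ) :
    toLex (shift n y) ≤ toLex b := by
  induction n with
  | zero => exact (code_le_iff hM 0).1 (h 0)
  | succ n ih =>
    rcases prevDigit_zero_or_one (y n) with hy | hy
    · have h1 := h ((unitLift M).length * (n + 1))
      rw [shift_code hM, show prevDigit 0 y (n + 1) = 0 from hy] at h1
      exact (code_le_iff hM 0).1 h1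
    · exact (shift_succ_le_of_last hy).trans ih

theorem shift_lt_of_shift_code_lt (hM : 1 ≤ M) {y : Omega 1}
    (h : ∀ n, toLex (shift n (code M 0 y)) < toLex (code M 0 b)) (n : ℕ) :
    toLex (shift n y) < toLex b := by
  induction n with
  | zero => exact (code_lt_iff hM 0).1 (h 0)
  | succ n ih =>
    rcases prevDigit_zero_or_one (y n) with hy | hy
    · have h1 := h ((unitLift M).length * (n + 1))
      rw [shift_code hM, show prevDigit 0 y (n + 1) = 0 from hy] at h1
      exact (code_lt_iff hM 0).1 h1
    · exact (shift_succ_le_of_last hy).trans_lt ih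

theorem le_ones (y : Omega 1) : toLex y ≤ toLex ones := by
  by_contra h
  obtain ⟨n, -, h2⟩ := lex_lt_iff.1 (not_le.1 h)
  exact absurd h2 (not_lt.2 (Fin.le_last _))

theorem zeros_le (y : Omega 1) : toLex zeros ≤ toLex y := by
  by_contra h
  obtain ⟨n, -, h2⟩ := lex_lt_iff.1 (not_le.1 h)
  exact absurd h2 (not_lt.2 (Fin.zero_le _))

theorem reflection_lt_of_first {y : Omega 1} (hb : b 0 = 1) (hy : y 0 = 1) :
    toLex (reflection b) < toLex y := by
  refine lex_lt_iff.2 ⟨0, by simp, ?_⟩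
  simp [reflection, hb, hy]

/-- The mirror argument: the reflected code starts in state 1, so the comparison takes place after a
digit 1, and dropping a leading 0 does not decrease a tail. The initial tail is settled by its first
digit. -/
theorem reflection_le_shift_of_code (hM : 1 ≤ M) (hb : b 0 = 1) {y : Omega 1} (hy : y 0 = 1)
    (h : ∀ n, toLex (reflection (code M 0 b)) ≤ toLex (shift n (code M 0 y))) (n : ℕ) :
    toLex (reflection b) ≤ toLex (shift n y) := by
  induction n with
  | zero => exact (reflection_lt_of_first hb hy).le
  | succ n ih =>
    rcases prevDigit_zero_or_one (y n) with hyn | hyn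
    · exact ih.trans (le_shift_succ_of_zero hyn)
    · have h1 := h ((unitLift M).length * (n + 1))
      rw [shift_code hM, show prevDigit 0 y (n + 1) = 1 from hyn, reflection_code hM] at h1
      exact (code_le_iff hM 1).1 h1

theorem reflection_lt_shift_of_code (hM : 1 ≤ M) (hb : b 0 = 1) {y : Omega 1} (hy : y 0 = 1)
    (h : ∀ n, toLex (reflection (code M 0 b)) < toLex (shift n (code M 0 y))) (n : ℕ) :
    toLex (reflection b) < toLex (shift n y) := by
  induction n with
  | zero => exact reflection_lt_of_first hb hy
  | succ n ih =>
    rcases prevDigit_zero_or_one (y n) with hyn | hyn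
    · exact ih.trans_le (le_shift_succ_of_zero hyn)
    · have h1 := h ((unitLift M).length * (n + 1))
      rw [shift_code hM, show prevDigit 0 y (n + 1) = 1 from hyn, reflection_code hM] at h1
      exact (code_lt_iff hM 1).1 h1

/-- Only boundaries in state 0 use the hypothesis. The initial state is arbitrary so that reflected
codes, which start in state 1, are covered too. -/
theorem shift_code_lt_of_shift_lt (hM : 1 ≤ M) (hb : b 0 = 1) (s : Fin 2) {y : Omega 1}
    (h : ∀ n, toLex (shift n y) < toLex b) (n : ℕ) :
    toLex (shift n (code M s y)) < toLex (code M 0 b) := by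
  by_cases hn : (unitLift M).length ∣ n
  · obtain ⟨m, rfl⟩ := hn
    rw [shift_code hM]
    rcases prevDigit_zero_or_one (prevDigit s y m) with hs | hs <;> rw [hs]
    · exact (code_lt_iff hM 0).2 (h m)
    · exact code_one_lt_code_zero hM _ hb
  · exact shift_code_lt hM s y hb hn

/-- The sequences of `tildeU M q` that begin with `𝐮⁺`. -/
def tildeUPlus (M : ℕ) (q : ℝ) : Set (Omega M) :=
  {x ∈ tildeU M q | initialWord (unitLift M).length x = (unitLift M).plus}

theorem boundedByOnes_of_mem_tildeU (hle : toLex (alpha M q) ≤ toLex (code M 0 ones))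
    {x : Omega M} (hx : x ∈ tildeU M q) : BoundedByOnes x := fun n =>
  ⟨(hx n).2.le.trans hle, ((reflection_mem_tildeU hx) n).2.le.trans hle⟩

theorem tildeUPlus_eq_image (hM : 1 ≤ M) (hb : b 0 = 1) (hα : alpha M q = code M 0 b)
    (hp : alpha 1 p = b) :
    tildeUPlus M q = code M 0 '' {y ∈ tildeU 1 p | y 0 = 1} := by
  have hle : toLex (alpha M q) ≤ toLex (code M 0 ones) := by
    rw [hα, code_le_iff hM]
    exact le_ones b
  ext x
  constructor
  · rintro ⟨hx, hx0⟩
    obtain ⟨y, hy, rfl⟩ := (boundedByOnes_of_mem_tildeU hle hx).exists_code hM hx0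
    refine ⟨y, ⟨fun n => ?_, hy⟩, rfl⟩
    rw [hp]
    rw [tildeU, hα] at hx
    exact ⟨reflection_lt_shift_of_code hM hb hy (fun n => (hx n).1) n,
      shift_lt_of_shift_code_lt hM (fun n => (hx n).2) n⟩
  · rintro ⟨y, ⟨hy, hy0⟩, rfl⟩
    refine ⟨fun n => ?_, (initialWord_code hM y).2 hy0⟩
    have h1 := fun n => (hy n).2
    have h2 := fun n => ((reflection_mem_tildeU hy) n).2
    rw [hp] at h1 h2
    rw [hα]
    refine ⟨?_, shift_code_lt_of_shift_lt hM hb 0 h1 n⟩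
    rw [reflection_lt, reflection_shift, reflection_code hM]
    exact shift_code_lt_of_shift_lt hM hb _ h2 n

theorem tildeU_subset_star : tildeU 1 p ⊆ {x | x ∈ {y ∈ tildeU 1 p | y 0 = 1} ∨
    reflection x ∈ {y ∈ tildeU 1 p | y 0 = 1}} := by
  intro x hx
  rcases prevDigit_zero_or_one (x 0) with h | h
  · exact Or.inr ⟨reflection_mem_tildeU hx, by simp [reflection, h]⟩
  · exact Or.inl ⟨hx, h⟩

theorem HasEntropy.of_prefix {W : Set (Omega M)} {e : ℝ} (hW : W ⊆ tildeU M q) (hne : W.Nonempty)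
    (h : ∀ x ∈ tildeU M q, ∃ s : Fin 2, (∀ i, x i = code M s (fun _ => s) i) ∨
      ∃ j, (∀ i < j, x i = code M s (fun _ => s) i) ∧
        (shift j x ∈ W ∨ reflection (shift j x) ∈ W)) (he : HasEntropy (tildeU M q) e) :
    HasEntropy W e := by
  -- Two choices of the initial word and two of reflecting or not.
  refine he.of_comparable (hne.mono hW) hne (C := 4) (fun n => ?_) (fun n => ?_)
  · have h1 := ncard_initialWords_le_of_prefix (ι := Fin 2) (fun s => code M s fun _ => s)
      (Y := {x | x ∈ W ∨ reflection x ∈ W}) (hne.mono fun x hx => Or.inl hx) h n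
    have h2 := ncard_initialWords_union_reflection W n
    rw [Fintype.card_fin] at h1
    calc _ ≤ _ := h1
      _ ≤ 2 * (n + 1) * (2 * (initialWords n W).ncard) := by gcongr
      _ = _ := by ring
  · exact (ncard_initialWords_mono hW n).trans (Nat.le_mul_of_pos_left _ (by positivity))

theorem HasEntropy.entropy_eq {X : Set (Omega M)} {e : ℝ} (h : HasEntropy X e) : entropy X = e :=
  Tendsto.limUnder_eq h

/-- Ensures that `𝐔̃_q` is non-empty even when no sequence in it begins with `𝐮⁺`. -/
theorem code_zeros_mem_tildeU (hM : 1 ≤ M) (hb : b 0 = 1) (hα : alpha M q = code M 0 b) :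
    code M 0 zeros ∈ tildeU M q := fun n => by
  have hlt : toLex zeros < toLex b := lex_lt_iff.2 ⟨0, by simp, by simp [zeros, hb]⟩
  rw [hα]
  refine ⟨?_, shift_code_lt_of_shift_lt hM hb 0 (y := zeros) (fun _ => hlt) n⟩
  rw [reflection_lt, reflection_shift, reflection_code hM]
  by_cases hn : (unitLift M).length ∣ n
  · obtain ⟨m, rfl⟩ := hn
    rw [shift_code hM, prevDigit_reflection, show prevDigit 0 zeros m = 0 by cases m <;> rfl]
    exact code_one_lt_code_zero hM _ hb
  · exact shift_code_lt hM _ _ hb hn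

/-- The entropies of the univoque sets of `q` and of the base `p` whose quasi-greedy expansion is
coded by that of `q`. -/
theorem exists_hasEntropy_of_alpha_eq_code (hM : 1 ≤ M) (hq : 1 < q) (hqM : q ≤ M + 1)
    (hp : 1 < p) (hpM : p ≤ (1 : ℕ) + 1) (hb : b 0 = 1) (hα : alpha M q = code M 0 b)
    (hpα : alpha 1 p = b) :
    ∃ e e', HasEntropy (univoqueSeqs M q) e ∧ HasEntropy (univoqueSeqs 1 p) e' ∧
      e = cConst M * e' := by
  have hne : (tildeU M q).Nonempty := ⟨_, code_zeros_mem_tildeU hM hb hα⟩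
  have hle : toLex (alpha M q) ≤ toLex (code M 0 ones) := by
    rw [hα, code_le_iff hM]
    exact le_ones b
  have himage := tildeUPlus_eq_image hM hb hα hpα
  have hprefix : ∀ x ∈ tildeU M q, ∃ s : Fin 2, (∀ i, x i = code M s (fun _ => s) i) ∨
      ∃ j, (∀ i < j, x i = code M s (fun _ => s) i) ∧
        (shift j x ∈ tildeUPlus M q ∨ reflection (shift j x) ∈ tildeUPlus M q) := by
    intro x hx
    obtain ⟨s, hs⟩ := (boundedByOnes_of_mem_tildeU hle hx).exists_prefix hM
    refine ⟨s, hs.imp_right ?_⟩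
    rintro ⟨j, hj, hj'⟩
    have hx' := shift_mem_tildeU hx j
    exact ⟨j, hj, hj'.imp (fun h => ⟨hx', h⟩) fun h => ⟨reflection_mem_tildeU hx', h⟩⟩
  have hL : ((unitLift M).length : ℝ) ≠ 0 := by exact_mod_cast (unitLift_length_pos M).ne'
  -- If this set is empty, `𝐔̃_q` contains at most two sequences and the binary `𝐔̃` is empty, so
  -- both entropies are 0; otherwise Fekete's lemma applies on both sides.
  rcases Set.eq_empty_or_nonempty {y ∈ tildeU 1 p | y 0 = 1} with hstar | hstar
  · have hW : tildeUPlus M q = ∅ := by rw [himage, hstar, Set.image_empty]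
    refine ⟨0, 0, hasEntropy_univoqueSeqs hM hq hqM hne ?_,
      hasEntropy_univoqueSeqs_of_isEmpty le_rfl hp hpM ?_, by simp⟩
    · refine hasEntropy_zero_of_finite
        ((Set.finite_range fun s : Fin 2 => code M s fun _ => s).subset fun x hx => ?_)
      obtain ⟨s, hs | ⟨j, -, hj⟩⟩ := hprefix x hx
      · exact ⟨s, funext fun i => (hs i).symm⟩
      · simp [hW] at hj
    · have h := tildeU_subset_star (p := p)
      rw [hstar] at h
      simpa [Set.subset_empty_iff] using h
  · have hW : (tildeUPlus M q).Nonempty := by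
      rw [himage]
      exact hstar.image _
    have hne' : (tildeU 1 p).Nonempty := hstar.mono fun x hx => hx.1
    obtain ⟨e, he⟩ := exists_hasEntropy_of_shift hne fun x hx n => shift_mem_tildeU hx n
    obtain ⟨e', he'⟩ := exists_hasEntropy_of_shift hne' fun x hx n => shift_mem_tildeU hx n
    refine ⟨e, e', hasEntropy_univoqueSeqs hM hq hqM hne he,
      hasEntropy_univoqueSeqs le_rfl hp hpM hne' he', ?_⟩
    have h1 := he.of_prefix (fun x hx => hx.1) hW hprefix
    -- Over `{0, 1}` every sequence begins with 1 up to reflection, so the cut is at 0 and the state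
    -- chosen is a dummy.
    have h2 := he'.of_prefix (fun x hx => hx.1) hstar
      fun x hx => ⟨0, Or.inr ⟨0, by simp, tildeU_subset_star hx⟩⟩
    have h3 := h1.eq_mul_of_ncard_eq (unitLift_length_pos M) h2 fun n => by
      rw [himage, initialWords, Set.image_image, initialWords]
      refine ncard_image_eq_of_kernel_eq _ fun y _ z _ => ?_
      rw [initialWord_eq_iff, initialWord_eq_iff]
      exact code_agree_iff hM 0 y z n
    rw [h3, cConst_eq]
    field_simp

/-- The quasi-greedy expansions in the interval `(q_G, q_T]` that belong to `seqV` are codes. -/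
theorem exists_alpha_eq_code (hM : 1 ≤ M) (hq : q ∈ Set.Ioc (qG M) (qT M))
    (hqV : q ∈ basesV M) : ∃ y : Omega 1, y 0 = 1 ∧ alpha M q = code M 0 y := by
  obtain ⟨-, hqM, hV⟩ := hqV
  obtain ⟨hG1, -, hG⟩ := alpha_qG hM
  obtain ⟨-, hTM, hT⟩ := alpha_qT hM
  have hq1 : 1 < q := hG1.trans hq.1
  have hlt := alpha_strictMono hG1 hq.1 hqM
  have hle : toLex (alpha M q) ≤ toLex (alpha M (qT M)) := by
    rcases hq.2.eq_or_lt with h | h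
    · rw [h]
    · exact (alpha_strictMono hq1 h hTM).le
  rw [hG] at hlt
  rw [hT] at hle
  refine BoundedByOnes.exists_code hM (fun n => ⟨(hV n).2.trans hle, ?_⟩)
    (initialWord_eq_plus_of_code_zeros_lt hM (fun n => (hV n).2) hlt hle)
  rw [← reflection_shift]
  exact (reflection_le.1 (hV n).1).trans hle

theorem mem_seqV_of_code (hM : 1 ≤ M) (hb : b 0 = 1) (h : code M 0 b ∈ seqV M) :
    b ∈ seqV 1 := fun n =>
  ⟨reflection_le_shift_of_code hM hb hb (fun n => (h n).1) n,
    shift_le_of_shift_code_le hM (fun n => (h n).2) n⟩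

/-- A tail `0^∞` would lie above the reflection of `b`, forcing `b = 1^∞`. -/
theorem not_eventually_zero_of_mem_seqV (h : b ∈ seqV 1) : ¬ ∃ N, ∀ i, N ≤ i → b i = 0 := by
  rintro ⟨N, hN⟩
  have h1 : shift N b = zeros := funext fun i => hN _ (Nat.le_add_left _ _)
  have h2 := (h N).1
  rw [h1] at h2
  have h3 := congrFun (toLex.injective (le_antisymm h2 (zeros_le _))) N
  simp [reflection, hN N le_rfl, zeros] at h3

end Main

end Univoque

open Univoque

theorem proposition3p4 (M : ℕ) (hM : 1 ≤ M) (q : ℝ)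
    (hq : q ∈ Set.Ioc (qG M) (qT M)) (hqV : q ∈ basesV M)
    (qhat : ℝ) (hqhat : qhat = baseMap (unitLift M) q) :
    -- `qhat` is well defined
    (alpha M q ∈ blockSeqs (unitLift M) ∧ qhat ∈ basesV 1 ∧
      alpha 1 qhat = blockMap (unitLift M) (alpha M q)) ∧
    -- (i)
    ({x ∈ tildeU M q | initialWord (unitLift M).length x = (unitLift M).plus} ⊆
        blockSeqs (unitLift M) ∧
      blockMap (unitLift M) ''
          {x ∈ tildeU M q | initialWord (unitLift M).length x = (unitLift M).plus} =
        {y ∈ tildeU 1 qhat | y 0 = 1}) ∧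
    -- (ii), both entropies being genuine limits
    (HasEntropy (univoqueSeqs M q) (entropyFn M q) ∧
      HasEntropy (univoqueSeqs 1 qhat) (entropyFn 1 qhat) ∧
      entropyFn M q = cConst M * entropyFn 1 qhat) := by
  obtain ⟨b, hb, hα⟩ := exists_alpha_eq_code hM hq hqV
  have hmap : blockMap (unitLift M) (alpha M q) = b := by rw [hα, blockMap_code hM hb]
  have hbV : b ∈ seqV 1 := mem_seqV_of_code hM hb (hα ▸ hqV.2.2)
  obtain ⟨hp, hpM, hpα⟩ := baseOf_spec le_rfl (not_eventually_zero_of_mem_seqV hbV)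
    fun n => (hbV n).2
  rw [baseMap, hmap] at hqhat
  rw [← hqhat] at hp hpM hpα
  have himage := tildeUPlus_eq_image hM hb hα hpα
  have hcomp : ∀ y ∈ {y ∈ tildeU 1 qhat | y 0 = 1},
      blockMap (unitLift M) (code M 0 y) = y := fun y hy => blockMap_code hM hy.2
  obtain ⟨e, e', he, he', hee⟩ :=
    exists_hasEntropy_of_alpha_eq_code hM hqV.1 hqV.2.1 hp hpM hb hα hpα
  have h1 : entropyFn M q = e := he.entropy_eq
  have h2 : entropyFn 1 qhat = e' := he'.entropy_eq
  refine ⟨⟨?_, ⟨hp, hpM, hpα ▸ hbV⟩, hpα.trans hmap.symm⟩, ⟨?_, ?_⟩, ?_⟩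
  · rw [hα]
    exact code_mem_blockSeqs hM hb
  · show tildeUPlus M q ⊆ _
    rw [himage]
    rintro _ ⟨y, hy, rfl⟩
    exact code_mem_blockSeqs hM hy.2
  · show blockMap (unitLift M) '' tildeUPlus M q = _
    rw [himage, Set.image_image, Set.image_congr hcomp, Set.image_id']
  · rw [h1, h2]
    exact ⟨he, he', hee⟩
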